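/- For $k\ge 2$ let $p_k(n)$ be the number of partitions of $n$ none of whose parts is divisible by $k$ ($k$-regular partitions). For a real sequence $\alpha$, let $J^{d,n}_{\alpha}(X)=\sum_{j=0}^{d}\binom{d}{j}\alpha(n+j)X^j$ be its Jensen polynomial of degree $d$ and shift $n$. Put $m_k=\frac{k-1}{24k}$ and, for $n\ge 1$, $$A_k(n)=2\pi\sqrt{\frac{m_k}{n}}+\frac34\sum_{r=1}^{\lfloor 3d/4\rfloor}\frac{(-1)^r}{r\,n^r},\qquad \delta_k(n)=\Bigl(-\sum_{r=2}^{\infty}\frac{4\pi\sqrt{m_k}\binom{1/2}{r}}{n^{r-1/2}}\Bigr)^{1/2},$$ and define the renormalized Jensen polynomials $$\widehat J^{d,n}_{p_k}(X)=\frac{\delta_k(n)^{-d}}{p_k(n)}\,J^{d,n}_{p_k}\!\left(\frac{\delta_k(n)X-1}{\exp(A_k(n))}\right).$$ Let $H_d(X)$ be the Hermite polynomials normalized by $\sum_{d\ge 0}H_d(X)\frac{t^d}{d!}=e^{Xt-t^2}$ (so $H_1=X$, $H_2=X^2-2$). Theorem. Let $k\ge 2$ and $d\ge 1$. Then $\lim_{n\to\infty}\widehat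 J^{d,n}_{p_k}(X)=H_d(X)$, uniformly for $X$ in compact subsets of $\mathbb R$. Moreover, there is $N$ (depending on $k$ and $d$) such that for all $n\ge N$ the polynomial $J^{d,n}_{p_k}(X)$ is hyperbolic, that is, all of its complex roots are real. -/

import Mathlib

noncomputable section

namespace RegularPartition

/-- The number `p_k(n)` of `k`-regular partitions of `n`: the partitions of `n` none of whose parts
is divisible by `k`. -/
def regularCount (k n : ℕ) : ℕ :=
  (Nat.Partition.restricted n (fun i => ¬ k ∣ i)).card

/-- The Jensen polynomial of degree `d` and shift `n` of a real sequence `α`,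
`∑_{j=0}^{d} (d choose j) α(n+j) X^j`. -/
def jensen (α : ℕ → ℝ) (d n : ℕ) : Polynomial ℝ :=
  ∑ j ∈ Finset.range (d + 1),
    Polynomial.C ((d.choose j : ℝ) * α (n + j)) * Polynomial.X ^ j

/-- The renormalized Jensen polynomial
`(δ(n)^{-d} / α(n)) * J_α^{d,n}((δ(n) X - 1) / exp(A(n)))`. -/
def renormalizedJensen (α A δ : ℕ → ℝ) (d n : ℕ) : Polynomial ℝ :=
  Polynomial.C ((δ n)⁻¹ ^ d / α n) *
    (jensen α d n).comp
      (Polynomial.C (Real.exp (A n))⁻¹ * (Polynomial.C (δ n) * Polynomial.X - 1))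

/-- The constant `m_k = (k - 1) / (24 k)`, so that `log p_k(n)` grows like `4 π √(m_k n)`. -/
def m (k : ℕ) : ℝ := ((k : ℝ) - 1) / (24 * (k : ℝ))

/-- `A_k(n) = 2 π √(m_k / n) + (3/4) ∑_{r=1}^{⌊3d/4⌋} (-1)^r / (r n^r)`
(the division `3 * d / 4` is that of natural numbers, i.e. the floor). -/
def A (k d n : ℕ) : ℝ :=
  2 * Real.pi * Real.sqrt (m k / (n : ℝ)) +
    3 / 4 * ∑ r ∈ Finset.Icc 1 (3 * d / 4), (-1 : ℝ) ^ r / ((r : ℝ) * (n : ℝ) ^ r)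

/-- `δ_k(n) = (- ∑_{r ≥ 2} 4 π √m_k (1/2 choose r) / n^{r - 1/2})^{1/2}`. The summation index is
shifted by two; the series converges absolutely for every `n ≥ 1`. -/
def delta (k n : ℕ) : ℝ :=
  Real.sqrt (-∑' r : ℕ, 4 * Real.pi * Real.sqrt (m k) * Ring.choose (1 / 2 : ℝ) (r + 2) /
    (n : ℝ) ^ (((r + 2 : ℕ) : ℝ) - 1 / 2))

/-- The renormalized Jensen polynomials of the `k`-regular partition function. -/
def renormalizedJensenRegular (k d n : ℕ) : Polynomial ℝ :=
  renormalizedJensen (fun i => (regularCount k i : ℝ)) (A k d) (delta k) d n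

/-- The Hermite polynomials normalized by `∑_d H_d(X) t^d / d! = exp(X t - t ^ 2)`, so that
`H_0 = 1`, `H_1 = X`, `H_2 = X^2 - 2`. Expanding the exponentials gives
`H_d = ∑_{0 ≤ j ≤ d/2} (-1)^j d! / (j! (d - 2j)!) X^{d - 2j}`. -/
def hermiteH (d : ℕ) : Polynomial ℝ :=
  ∑ j ∈ Finset.range (d / 2 + 1),
    Polynomial.C ((-1 : ℝ) ^ j * (d.factorial : ℝ) /
      ((j.factorial : ℝ) * ((d - 2 * j).factorial : ℝ))) * Polynomial.X ^ (d - 2 * j)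

/-- A real polynomial is hyperbolic if all its complex roots are real. -/
def IsHyperbolic (p : Polynomial ℝ) : Prop :=
  ∀ z : ℂ, Polynomial.aeval z p = 0 → z.im = 0

end RegularPartition

end

/-! ### Hermite polynomials: recurrences, and real-rootedness from sign changes -/

namespace RegularPartition

open Polynomial

/-! At q = exp(-z) the generating function of p_k equals exp(L(z)), where L is `logGen`. For every x
> 0, Cauchy's formula writes 2π p_k(n+j) as the integral of exp(L(z) + (n+j)z) over z = x + iθ, |θ|
≤ π. By the binomial theorem, 2π J^{d,n}(Y) is then one integral with the extra factor (1 + Y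
e^z)^d. For x = A_k(n), θ = δ s and Y = (δX - 1)e^{-x}, that factor is δ^d times a quantity tending
to (X - is)^d. The case d = 0 is p_k(n) itself, so in the quotient all prefactors cancel
(`eval_renormalizedJensenRegular`), and no asymptotic formula for p_k(n) is needed.

Near 0, L behaves like C/z with C = (2π√m_k)^2. The abscissa A_k(n) is close enough to the saddle
point √(C/n) of C/x + nx, and δ_k(n) is the matching width, so the integrand normalized at θ = 0
tends to exp(-s²/4) (`IsSaddle.tendsto_weight`). Domination comes from a minor-arc estimate: moving
from x to x + iθ lowers Re L by at least (c/x) min(1, (θ/x)²) (`exists_kernel_gap`, `logGen_gap`),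
which beats any prescribed power of 1 + s² (`IsSaddle.eventually_norm_weight_le`). The limit is a
quotient of Gaussian integrals, equal to H_d(X) through integration by parts
(`integral_gaussian_mul_pow`). Since degrees are at most d, pointwise convergence is locally
uniform.

For hyperbolicity, H_d alternates in sign along d + 1 points (`exists_alternating_hermiteH`). For
large n the renormalized polynomial has the same signs there, and its degree is at most d, so all
its roots are real. The renormalization is a real affine substitution, so the roots of the Jensen
polynomial are real as well. -/

theorem coeff_hermiteH (d i : ℕ) : (hermiteH d).coeff i =
    if i ≤ d ∧ Even (d - i) then
      (-1 : ℝ) ^ ((d - i) / 2) * d.factorial / (((d - i) / 2).factorial * i.factorial) else 0 := by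
  rw [hermiteH, finsetSum_coeff]
  simp only [coeff_C_mul, coeff_X_pow]
  split_ifs with h
  · obtain ⟨hi, c, hc⟩ := h
    rw [Finset.sum_eq_single c]
    · have h1 : i = d - 2 * c := by omega
      have h2 : (d - i) / 2 = c := by omega
      rw [if_pos h1, h2, ← h1]; ring
    · intro b hb hbc
      rw [Finset.mem_range] at hb
      rw [if_neg (by omega), mul_zero]
    · intro hcn
      rw [Finset.mem_range] at hcn
      omega
  · refine Finset.sum_eq_zero fun b hb => ?_
    rw [Finset.mem_range] at hb
    rw [if_neg, mul_zero]
    rintro rfl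
    exact h ⟨by omega, ⟨b, by omega⟩⟩

theorem hermiteH_zero : hermiteH 0 = 1 := by simp [hermiteH]

theorem hermiteH_one : hermiteH 1 = X := by simp [hermiteH]

theorem derivative_hermiteH_succ (d : ℕ) :
    derivative (hermiteH (d + 1)) = C ((d : ℝ) + 1) * hermiteH d := by
  ext i
  rw [coeff_derivative, coeff_C_mul, coeff_hermiteH, coeff_hermiteH]
  simp only [Nat.add_sub_add_right, Nat.add_le_add_iff_right]
  split_ifs
  · rw [Nat.factorial_succ, Nat.factorial_succ i]
    push_cast
    have : (i : ℝ) + 1 ≠ 0 := by positivity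
    field_simp
  · simp

theorem hermiteH_add_two (d : ℕ) :
    hermiteH (d + 2) = X * hermiteH (d + 1) - C (2 * ((d : ℝ) + 1)) * hermiteH d := by
  ext i
  rw [coeff_sub, coeff_C_mul]
  rcases i with _ | i
  · rw [coeff_X_mul_zero, coeff_hermiteH, coeff_hermiteH]
    simp only [Nat.sub_zero, Nat.zero_le, true_and, Nat.even_add, even_two, iff_true]
    split_ifs with h
    · obtain ⟨c, rfl⟩ := h
      have h1 : (c + c + 2) / 2 = c + 1 := by omega
      have h2 : (c + c) / 2 = c := by omega
      rw [h1, h2, pow_succ]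
      simp only [Nat.factorial_succ]
      push_cast
      field_simp
      ring
    · simp
  · rw [coeff_X_mul, coeff_hermiteH, coeff_hermiteH, coeff_hermiteH]
    by_cases h : i ≤ d + 1 ∧ Even (d + 1 - i)
    · obtain ⟨hi, c, hc⟩ := h
      rw [if_pos (⟨by omega, c, by omega⟩ : i + 1 ≤ d + 2 ∧ Even (d + 2 - (i + 1))),
        if_pos ⟨hi, c, hc⟩]
      have h1 : (d + 2 - (i + 1)) / 2 = c := by omega
      have h2 : (d + 1 - i) / 2 = c := by omega
      rw [h1, h2]
      rcases c with _ | c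
      · rw [if_neg (by omega)]
        obtain rfl : i = d + 1 := by omega
        simp only [Nat.factorial_succ]
        push_cast
        field_simp
        simp
      · rw [if_pos ⟨by omega, c, by omega⟩]
        have h3 : (d - (i + 1)) / 2 = c := by omega
        have h4 : (d : ℝ) = i + 1 + 2 * c := by
          have : d = i + 1 + 2 * c := by omega
          exact_mod_cast this
        rw [h3, pow_succ]
        simp only [Nat.factorial_succ]
        push_cast
        have : (i : ℝ) + 1 ≠ 0 := by positivity
        rw [h4]
        field_simp
        ring
    · rw [if_neg h, if_neg, if_neg]
      · simp
      · rintro ⟨h1, c, hc⟩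
        exact h ⟨by omega, c + 1, by omega⟩
      · rintro ⟨h1, c, hc⟩
        exact h ⟨by omega, c, by omega⟩

theorem hermiteH_succ (d : ℕ) :
    hermiteH (d + 1) = X * hermiteH d - C 2 * derivative (hermiteH d) := by
  rcases d with _ | d
  · simp [hermiteH_zero, hermiteH_one]
  · rw [hermiteH_add_two, derivative_hermiteH_succ, ← mul_assoc, ← C_mul]

theorem natDegree_hermiteH_le (d : ℕ) : (hermiteH d).natDegree ≤ d := by
  rw [natDegree_le_iff_coeff_eq_zero]
  intro i hi
  rw [coeff_hermiteH, if_neg (by omega)]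

theorem coeff_hermiteH_self (d : ℕ) : (hermiteH d).coeff d = 1 := by
  rw [coeff_hermiteH, if_pos (by simp)]
  simp [Nat.factorial_ne_zero]

/-- A polynomial of degree at most `D` vanishing at `D` distinct points is a constant multiple of
the product of the corresponding linear factors. -/
theorem eq_C_mul_prod_of_roots {p : ℝ[X]} {D : ℕ} (hp : p.natDegree ≤ D) {r : ℕ → ℝ}
    (hr : StrictMonoOn r (Set.Iio D)) (h0 : ∀ i < D, p.eval (r i) = 0) :
    p = C (p.coeff D) * ∏ i ∈ Finset.range D, (X - C (r i)) := by
  have hinj : Set.InjOn r (Finset.range D : Set ℕ) := by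
    intro a ha b hb hab
    exact hr.injOn (by simpa using ha) (by simpa using hb) hab
  have hdvd : ∏ i ∈ Finset.range D, (X - C (r i)) ∣ p := by
    refine Finset.prod_dvd_of_coprime ?_ ?_
    · intro a ha b hb hab
      exact isCoprime_X_sub_C_of_isUnit_sub
        (sub_ne_zero.2 fun h => hab (hinj ha hb h)).isUnit
    · intro i hi
      exact dvd_iff_isRoot.2 (h0 i (Finset.mem_range.1 hi))
  have hmon : (∏ i ∈ Finset.range D, (X - C (r i))).Monic :=
    monic_prod_of_monic _ _ fun i _ => monic_X_sub_C _
  have hdeg : (∏ i ∈ Finset.range D, (X - C (r i))).natDegree = D := by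
    rw [natDegree_prod_of_monic _ _ fun i _ => monic_X_sub_C _]
    simp
  obtain ⟨q, hq⟩ := hdvd
  have hq0 : q.natDegree = 0 := by
    by_cases h : q = 0
    · simp [h]
    · have := hmon.natDegree_mul' h
      rw [← hq, hdeg] at this
      omega
  obtain ⟨c, rfl⟩ : ∃ c, q = C c := ⟨_, eq_C_of_natDegree_eq_zero hq0⟩
  have : p.coeff D = c := by
    rw [hq, coeff_mul_C]
    have := hmon.coeff_natDegree
    rw [hdeg] at this
    rw [this, one_mul]
  rw [this, mul_comm]
  exact hq

theorem exists_roots_of_alternating {p : ℝ[X]} {D : ℕ} {y : ℕ → ℝ}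
    (hy : ∀ i < D, y i < y (i + 1)) (h : ∀ i < D, p.eval (y i) * p.eval (y (i + 1)) < 0) :
    ∃ r : ℕ → ℝ, StrictMonoOn r (Set.Iio D) ∧
      ∀ i < D, p.eval (r i) = 0 ∧ y i < r i ∧ r i < y (i + 1) := by
  have key : ∀ i, ∃ x, i < D → p.eval x = 0 ∧ y i < x ∧ x < y (i + 1) := by
    intro i
    by_cases hi : i < D
    · have hc : ContinuousOn (fun x => p.eval x) (Set.Icc (y i) (y (i + 1))) :=
        p.continuous.continuousOn
      rcases mul_neg_iff.1 (h i hi) with ⟨h1, h2⟩ | ⟨h1, h2⟩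
      · obtain ⟨x, hx, hx0⟩ := intermediate_value_Ioo' (hy i hi).le hc ⟨h2, h1⟩
        exact ⟨x, fun _ => ⟨hx0, hx⟩⟩
      · obtain ⟨x, hx, hx0⟩ := intermediate_value_Ioo (hy i hi).le hc ⟨h1, h2⟩
        exact ⟨x, fun _ => ⟨hx0, hx⟩⟩
    · exact ⟨0, fun h => absurd h hi⟩
  choose r hr using key
  refine ⟨r, ?_, hr⟩
  -- The open intervals containing the chosen roots are disjoint and ordered, so the roots increase
  -- strictly.
  have hmono : ∀ j, ∀ i < j, j < D → y (i + 1) ≤ y j := by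
    intro j
    induction j with
    | zero => intro i hi; omega
    | succ j ih =>
      intro i hi hj
      rcases Nat.lt_succ_iff_lt_or_eq.1 hi with h1 | rfl
      · exact (ih i h1 (by omega)).trans (hy j (by omega)).le
      · exact le_rfl
  intro i hi j hj hij
  exact ((hr i hi).2.2.trans_le (hmono j i hij hj)).trans (hr j hj).2.1

/-- The D sign changes already give D distinct real roots, which exhaust the degree. Only signs at
finitely many points enter, so the criterion is stable under pointwise limits. -/
theorem isHyperbolic_of_alternating {p : ℝ[X]} {D : ℕ} (hD : 1 ≤ D) (hp : p.natDegree ≤ D)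
    {y : ℕ → ℝ} (hy : ∀ i < D, y i < y (i + 1))
    (h : ∀ i < D, p.eval (y i) * p.eval (y (i + 1)) < 0) : IsHyperbolic p := by
  obtain ⟨r, hr, h0⟩ := exists_roots_of_alternating hy h
  have hpr := eq_C_mul_prod_of_roots hp hr fun i hi => (h0 i hi).1
  intro z hz
  have hc : p.coeff D ≠ 0 := by
    intro hc
    rw [hc, C_0, zero_mul] at hpr
    have := h 0 hD
    simp [hpr] at this
  rw [hpr, map_mul, map_prod, mul_eq_zero, Finset.prod_eq_zero_iff] at hz
  rcases hz with hz | ⟨i, -, hi⟩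
  · simp [hc] at hz
  · rw [map_sub, aeval_X, aeval_C, sub_eq_zero] at hi
    simp [hi]

end RegularPartition

/-! ### Sign alternation of the Hermite polynomials by interlacing -/

namespace RegularPartition

open Polynomial

theorem eval_derivative_prod_X_sub_C (r : ℕ → ℝ) (d : ℕ) (x : ℝ) :
    (derivative (∏ i ∈ Finset.range d, (X - C (r i)))).eval x =
      ∑ i ∈ Finset.range d, ∏ j ∈ (Finset.range d).erase i, (x - r j) := by
  rw [derivative_prod_finset, eval_finsetSum]
  refine Finset.sum_congr rfl fun i hi => ?_
  simp [eval_prod]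

theorem eval_derivative_prod_X_sub_C_root (r : ℕ → ℝ) {d i : ℕ} (hi : i < d) :
    (derivative (∏ j ∈ Finset.range d, (X - C (r j)))).eval (r i) =
      ∏ j ∈ (Finset.range d).erase i, (r i - r j) := by
  rw [eval_derivative_prod_X_sub_C]
  refine Finset.sum_eq_single i (fun b hb hbi => ?_) (fun h => absurd (Finset.mem_range.2 hi) h)
  exact Finset.prod_eq_zero (i := i) (Finset.mem_erase.2 ⟨hbi.symm, Finset.mem_range.2 hi⟩) (by simp)

/-- With p the product and S = ∑ 1/(x - r_i), one has p' = pS and |S| ≤ d, so xp - 2p' = p(x - 2S)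
has the sign of xp once |x| > 2d. Applied to H_{d+1} = X H_d - 2 H_d', it fixes the sign of H_{d+1}
far out on both sides. -/
theorem mul_eval_sub_derivative_pos {r : ℕ → ℝ} {d : ℕ} {x : ℝ}
    (h1 : ∀ i < d, 1 ≤ |x - r i|) (hx : 2 * d < |x|) :
    0 < x * ((∏ i ∈ Finset.range d, (X - C (r i))).eval x *
      (x * (∏ i ∈ Finset.range d, (X - C (r i))).eval x -
        2 * (derivative (∏ i ∈ Finset.range d, (X - C (r i)))).eval x)) := by
  have hne : ∀ i < d, x - r i ≠ 0 := fun i hi h => by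
    have := h1 i hi
    rw [h, abs_zero] at this
    linarith
  have hp : (∏ i ∈ Finset.range d, (X - C (r i))).eval x = ∏ i ∈ Finset.range d, (x - r i) := by
    simp [eval_prod]
  have hp0 : ∏ i ∈ Finset.range d, (x - r i) ≠ 0 :=
    Finset.prod_ne_zero_iff.2 fun i hi => hne i (Finset.mem_range.1 hi)
  have hd : (derivative (∏ i ∈ Finset.range d, (X - C (r i)))).eval x =
      (∏ i ∈ Finset.range d, (x - r i)) * ∑ i ∈ Finset.range d, (x - r i)⁻¹ := by
    rw [eval_derivative_prod_X_sub_C, Finset.mul_sum]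
    refine Finset.sum_congr rfl fun i hi => ?_
    rw [← Finset.mul_prod_erase _ _ hi]
    have := hne i (Finset.mem_range.1 hi)
    field_simp
  have hs : |∑ i ∈ Finset.range d, (x - r i)⁻¹| ≤ d := by
    refine (Finset.abs_sum_le_sum_abs _ _).trans ?_
    refine (Finset.sum_le_card_nsmul _ _ 1 fun i hi => ?_).trans (by simp)
    rw [abs_inv]
    exact inv_le_one_of_one_le₀ (h1 i (Finset.mem_range.1 hi))
  rw [hp, hd]
  set P := ∏ i ∈ Finset.range d, (x - r i)
  set S := ∑ i ∈ Finset.range d, (x - r i)⁻¹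
  have hxs : 0 < x * (x - 2 * S) := by
    have h2 : |x * S| ≤ |x| * d := by rw [abs_mul]; gcongr
    have h3 : x * x = |x| * |x| := (abs_mul_abs_self x).symm
    have h4 := le_abs_self (x * S)
    have h5 : 0 < |x| := lt_of_le_of_lt (by positivity) hx
    nlinarith
  have : x * (P * (x * P - 2 * (P * S))) = P ^ 2 * (x * (x - 2 * S)) := by ring
  rw [this]
  positivity

/-- Interlacing: at a root r_i of H_d the recurrence leaves H_{d+1}(r_i) = -2 H_d'(r_i), and H_d'
alternates in sign along consecutive simple roots. One far point on each side supplies the two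
remaining sign changes. -/
theorem exists_alternating_hermiteH (d : ℕ) (hd : 1 ≤ d) : ∃ y : ℕ → ℝ,
    (∀ i < d, y i < y (i + 1)) ∧
      ∀ i < d, (hermiteH d).eval (y i) * (hermiteH d).eval (y (i + 1)) < 0 := by
  induction d, hd using Nat.le_induction with
  | base =>
    refine ⟨fun i => 2 * i - 1, ?_, ?_⟩
    · intro i hi; push_cast; linarith
    · intro i hi
      obtain rfl : i = 0 := by omega
      simp [hermiteH_one]
  | succ d hd ih =>
    obtain ⟨y, hy, hyalt⟩ := ih
    obtain ⟨r, hr, h0⟩ := exists_roots_of_alternating hy hyalt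
    have hpr := eq_C_mul_prod_of_roots (natDegree_hermiteH_le d) hr fun i hi => (h0 i hi).1
    rw [coeff_hermiteH_self, C_1, one_mul] at hpr
    set p := ∏ i ∈ Finset.range d, (X - C (r i)) with hpdef
    have hQ : ∀ x, (hermiteH (d + 1)).eval x = x * p.eval x - 2 * (derivative p).eval x := by
      intro x
      rw [hermiteH_succ, hpr]
      simp
    have hpeval : ∀ x, p.eval x = ∏ i ∈ Finset.range d, (x - r i) := by
      intro x; simp [hpdef, eval_prod]
    have hQr : ∀ i < d, (hermiteH (d + 1)).eval (r i) =
        -2 * ∏ j ∈ (Finset.range d).erase i, (r i - r j) := by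
      intro i hi
      rw [hQ, hpdef, eval_derivative_prod_X_sub_C_root r hi, ← hpdef, ← hpr, (h0 i hi).1]
      ring
    have hmono : ∀ i j, i < j → j < d → r i < r j := fun i j hij hj =>
      hr (Set.mem_Iio.2 (hij.trans hj)) (Set.mem_Iio.2 hj) hij
    -- Large enough that |±Y| > 2d and that ±Y lies at distance at least 1 from every root.
    set Y : ℝ := 2 * d + 1 + ∑ j ∈ Finset.range d, |r j| with hY
    have hsum : ∀ i < d, |r i| ≤ ∑ j ∈ Finset.range d, |r j| := fun i hi =>
      Finset.single_le_sum (f := fun j => |r j|) (fun _ _ => abs_nonneg _) (Finset.mem_range.2 hi)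
    have hsum0 : 0 ≤ ∑ j ∈ Finset.range d, |r j| := Finset.sum_nonneg fun _ _ => abs_nonneg _
    have hd0 : (0 : ℝ) ≤ d := Nat.cast_nonneg d
    have hY0 : 0 < Y := by linarith
    have hrY : ∀ i < d, r i + 1 ≤ Y ∧ -Y ≤ r i - 1 := fun i hi => by
      have h1 := hsum i hi
      have h2 := le_abs_self (r i)
      have h3 := neg_abs_le (r i)
      constructor <;> linarith
    have hYpos : 0 < p.eval Y * (hermiteH (d + 1)).eval Y := by
      rw [hQ]
      refine pos_of_mul_pos_right
        (mul_eval_sub_derivative_pos (r := r) (d := d) (x := Y) ?_ ?_) hY0.le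
      · intro i hi
        rw [le_abs]
        left; linarith [(hrY i hi).1]
      · rw [abs_of_pos hY0]; linarith
    have hYneg : p.eval (-Y) * (hermiteH (d + 1)).eval (-Y) < 0 := by
      rw [hQ]
      have := mul_eval_sub_derivative_pos (r := r) (d := d) (x := -Y) ?_ ?_
      · rw [← hpdef] at this
        nlinarith
      · intro i hi
        rw [le_abs]
        right; linarith [(hrY i hi).2]
      · rw [abs_neg, abs_of_pos hY0]; linarith
    -- The d + 2 test points are -Y, r_0, ..., r_{d-1}, Y, whence the index shift.
    refine ⟨fun i => if i = 0 then -Y else if i ≤ d then r (i - 1) else Y, ?_, ?_⟩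
    · intro i hi
      rcases i with _ | i
      · simp only [if_true, Nat.add_one_ne_zero, if_false]
        rw [if_pos (by omega)]
        linarith [(hrY 0 (by omega)).2]
      · simp only [Nat.add_one_ne_zero, if_false, Nat.add_sub_cancel]
        rw [if_pos (by omega)]
        split_ifs
        · exact hmono _ _ (by omega) (by omega)
        · linarith [(hrY i (by omega)).1]
    · intro i hi
      rcases i with _ | i
      · simp only [if_true, Nat.add_one_ne_zero, if_false]
        rw [if_pos (by omega), zero_add, Nat.sub_self]
        -- Signs are compared through p(-Y): H_{d+1}(r_0) shares its sign, while H_{d+1}(-Y) has the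
        -- opposite one.
        have h1 : 0 < p.eval (-Y) * (hermiteH (d + 1)).eval (r 0) := by
          rw [hQr 0 (by omega), hpeval,
            ← Finset.mul_prod_erase _ _ (Finset.mem_range.2 (by omega : 0 < d))]
          have h2 : 0 < (∏ j ∈ (Finset.range d).erase 0, (-Y - r j)) *
              ∏ j ∈ (Finset.range d).erase 0, (r 0 - r j) := by
            rw [← Finset.prod_mul_distrib]
            refine Finset.prod_pos fun j hj => ?_
            rw [Finset.mem_erase, Finset.mem_range] at hj
            refine mul_pos_of_neg_of_neg ?_ ?_
            · linarith [(hrY j hj.2).2]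
            · linarith [hmono 0 j (by omega) hj.2]
          have h3 : 0 < Y + r 0 := by linarith [(hrY 0 (by omega)).2]
          have : (-Y - r 0) * (∏ j ∈ (Finset.range d).erase 0, (-Y - r j)) *
              (-2 * ∏ j ∈ (Finset.range d).erase 0, (r 0 - r j)) = 2 * (Y + r 0) *
              ((∏ j ∈ (Finset.range d).erase 0, (-Y - r j)) *
              ∏ j ∈ (Finset.range d).erase 0, (r 0 - r j)) := by ring
          rw [this]
          positivity
        have h2 := mul_neg_of_neg_of_pos hYneg h1
        have h3 : p.eval (-Y) * (hermiteH (d + 1)).eval (-Y) *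
            (p.eval (-Y) * (hermiteH (d + 1)).eval (r 0)) = p.eval (-Y) ^ 2 *
            ((hermiteH (d + 1)).eval (-Y) * (hermiteH (d + 1)).eval (r 0)) := by ring
        rw [h3] at h2
        by_contra! h4
        exact absurd (mul_nonneg (sq_nonneg (p.eval (-Y))) h4) (not_le.2 h2)
      · simp only [Nat.add_one_ne_zero, if_false, Nat.add_sub_cancel]
        rw [if_pos (by omega)]
        split_ifs with hid
        · have hi1 : i + 1 < d := by omega
          rw [hQr i (by omega), hQr (i + 1) hi1]
          have e1 : i + 1 ∈ (Finset.range d).erase i := by simp [hi1]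
          have e2 : i ∈ (Finset.range d).erase (i + 1) := by simp; omega
          rw [← Finset.mul_prod_erase _ _ e1, ← Finset.mul_prod_erase _ _ e2,
            Finset.erase_right_comm (a := i + 1)]
          -- No other root lies between r_i and r_{i+1}, so the remaining factors agree in sign; the
          -- change comes from r_i - r_{i+1} against r_{i+1} - r_i.
          have h2 : 0 < (∏ j ∈ ((Finset.range d).erase i).erase (i + 1), (r i - r j)) *
              ∏ j ∈ ((Finset.range d).erase i).erase (i + 1), (r (i + 1) - r j) := by
            rw [← Finset.prod_mul_distrib]
            refine Finset.prod_pos fun j hj => ?_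
            simp only [Finset.mem_erase, Finset.mem_range] at hj
            rcases lt_or_ge j i with hji | hji
            · exact mul_pos (by linarith [hmono j i hji (by omega)])
                (by linarith [hmono j (i + 1) (by omega) (by omega)])
            · exact mul_pos_of_neg_of_neg (by linarith [hmono i j (by omega) (by omega)])
                (by linarith [hmono (i + 1) j (by omega) (by omega)])
          have h3 := hmono i (i + 1) (by omega) hi1
          set U := ∏ j ∈ ((Finset.range d).erase i).erase (i + 1), (r i - r j)
          set V := ∏ j ∈ ((Finset.range d).erase i).erase (i + 1), (r (i + 1) - r j)
          have : -2 * ((r i - r (i + 1)) * U) * (-2 * ((r (i + 1) - r i) * V)) =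
              -(4 * (r (i + 1) - r i) ^ 2 * (U * V)) := by ring
          rw [this, neg_lt_zero]
          have : 0 < r (i + 1) - r i := by linarith
          positivity
        · obtain rfl : d = i + 1 := by omega
          have hp : 0 < p.eval Y := by
            rw [hpeval]
            exact Finset.prod_pos fun j hj => by
              linarith [(hrY j (Finset.mem_range.1 hj)).1]
          refine mul_neg_of_neg_of_pos ?_ (pos_of_mul_pos_right hYpos hp.le)
          rw [hQr i (by omega)]
          have : 0 < ∏ j ∈ (Finset.range (i + 1)).erase i, (r i - r j) := by
            refine Finset.prod_pos fun j hj => ?_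
            simp only [Finset.mem_erase, Finset.mem_range] at hj
            linarith [hmono j i (by omega) (by omega)]
          linarith

end RegularPartition

/-! ### Hermite polynomials as Gaussian integrals -/

namespace RegularPartition

open Polynomial MeasureTheory

theorem exp_neg_mul_one_add_pow_le (D : ℕ) {t : ℝ} (ht : 0 ≤ t) :
    Real.exp (-t) * (1 + t) ^ D ≤ D.factorial * Real.exp 1 := by
  have h := Real.pow_div_factorial_le_exp (1 + t) (by linarith) D
  rw [div_le_iff₀ (by positivity), Real.exp_add] at h
  calc Real.exp (-t) * (1 + t) ^ D ≤ Real.exp (-t) * (Real.exp 1 * Real.exp t * D.factorial) := by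
        gcongr
    _ = (Real.exp (-t) * Real.exp t) * (D.factorial * Real.exp 1) := by ring
    _ = _ := by rw [← Real.exp_add]; simp

theorem add_abs_pow_le (X s : ℝ) (d : ℕ) :
    (|X| + |s|) ^ d ≤ (|X| + 1) ^ d * (1 + s ^ 2) ^ d := by
  rw [← mul_pow]
  refine pow_le_pow_left₀ (by positivity) ?_ d
  have h1 := abs_nonneg X
  have h2 : |s| ≤ 1 + s ^ 2 := by
    rw [← sq_abs]; nlinarith [sq_nonneg (|s| - 1), abs_nonneg s]
  nlinarith [sq_nonneg s, mul_nonneg h1 (sq_nonneg s)]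

theorem norm_sub_I_mul_pow_le (X s : ℝ) (d : ℕ) :
    ‖((X : ℂ) - Complex.I * s) ^ d‖ ≤ (|X| + |s|) ^ d := by
  rw [norm_pow]
  refine pow_le_pow_left₀ (norm_nonneg _) ?_ d
  refine (norm_sub_le _ _).trans ?_
  simp

theorem integrable_gaussian_mul_pow (X : ℝ) (d : ℕ) :
    Integrable fun s : ℝ => (Real.exp (-s ^ 2 / 4) : ℂ) * ((X : ℂ) - Complex.I * s) ^ d := by
  have hb : Integrable fun s : ℝ =>
      (4 : ℝ) ^ (d + 1) * ((d + 1).factorial * Real.exp 1) * (|X| + 1) ^ d * (1 + s ^ 2)⁻¹ :=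
    integrable_inv_one_add_sq.const_mul _
  refine hb.mono' (by fun_prop) (Filter.Eventually.of_forall fun s => ?_)
  rw [norm_mul, Complex.norm_real, Real.norm_of_nonneg (Real.exp_pos _).le]
  have h1 := exp_neg_mul_one_add_pow_le (d + 1) (t := s ^ 2 / 4) (by positivity)
  have h2 : ((1 + s ^ 2) / 4) ^ (d + 1) ≤ (1 + s ^ 2 / 4) ^ (d + 1) := by
    refine pow_le_pow_left₀ (by positivity) ?_ _
    linarith
  have h3 : Real.exp (-s ^ 2 / 4) * (1 + s ^ 2) ^ (d + 1) ≤
      4 ^ (d + 1) * ((d + 1).factorial * Real.exp 1) := by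
    have h4 : Real.exp (-s ^ 2 / 4) * ((1 + s ^ 2) / 4) ^ (d + 1) ≤
        (d + 1).factorial * Real.exp 1 := by
      refine le_trans ?_ h1
      rw [neg_div]
      gcongr
    rw [div_pow, mul_div_assoc', div_le_iff₀ (by positivity)] at h4
    linarith
  calc _ ≤ Real.exp (-s ^ 2 / 4) * ((|X| + 1) ^ d * (1 + s ^ 2) ^ d) := by
        gcongr
        exact (norm_sub_I_mul_pow_le X s d).trans (add_abs_pow_le X s d)
    _ = Real.exp (-s ^ 2 / 4) * (1 + s ^ 2) ^ (d + 1) * (|X| + 1) ^ d * (1 + s ^ 2)⁻¹ := by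
        field_simp
        ring
    _ ≤ _ := by gcongr

theorem hasDerivAt_gaussian_mul_pow (X s : ℝ) (d : ℕ) :
    HasDerivAt (fun s : ℝ => (Real.exp (-s ^ 2 / 4) : ℂ) * ((X : ℂ) - Complex.I * s) ^ d)
      ((Real.exp (-s ^ 2 / 4) : ℂ) * (-s / 2 * ((X : ℂ) - Complex.I * s) ^ d -
        Complex.I * d * ((X : ℂ) - Complex.I * s) ^ (d - 1))) s := by
  have h1 : HasDerivAt (fun s : ℝ => Real.exp (-s ^ 2 / 4))
      (Real.exp (-s ^ 2 / 4) * (-(2 * s) / 4)) s := by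
    have := ((hasDerivAt_pow 2 s).neg.div_const 4).exp
    simpa using this
  have h2 : HasDerivAt (fun s : ℝ => (X : ℂ) - Complex.I * s) (-Complex.I) s := by
    have := ((Complex.ofRealCLM.hasDerivAt (x := s)).const_mul Complex.I).const_sub (X : ℂ)
    simpa using this
  have h3 := h1.ofReal_comp.mul (h2.fun_pow d)
  refine h3.congr_deriv ?_
  push_cast
  ring

theorem integral_deriv_gaussian_mul_pow (X : ℝ) (d : ℕ) :
    Integrable (fun s : ℝ => (Real.exp (-s ^ 2 / 4) : ℂ) *
      (-s / 2 * ((X : ℂ) - Complex.I * s) ^ d -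
        Complex.I * d * ((X : ℂ) - Complex.I * s) ^ (d - 1))) ∧
    ∫ s : ℝ, (Real.exp (-s ^ 2 / 4) : ℂ) * (-s / 2 * ((X : ℂ) - Complex.I * s) ^ d -
        Complex.I * d * ((X : ℂ) - Complex.I * s) ^ (d - 1)) = 0 := by
  have hI : Integrable (fun s : ℝ => (Real.exp (-s ^ 2 / 4) : ℂ) *
      (-s / 2 * ((X : ℂ) - Complex.I * s) ^ d -
        Complex.I * d * ((X : ℂ) - Complex.I * s) ^ (d - 1))) := by
    -- The factor s is absorbed through -s/2 = ((X - is) - X)/(2i), which leaves only Gaussian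
    -- moments already known to be integrable.
    have := (((integrable_gaussian_mul_pow X (d + 1)).const_mul (1 / (2 * Complex.I))).sub
      ((integrable_gaussian_mul_pow X d).const_mul (X / (2 * Complex.I)))).sub
      ((integrable_gaussian_mul_pow X (d - 1)).const_mul (Complex.I * d))
    refine this.congr (Filter.Eventually.of_forall fun s => ?_)
    simp only [Pi.sub_apply]
    have hi := Complex.I_ne_zero
    field_simp
    ring
  exact ⟨hI, integral_eq_zero_of_hasDerivAt_of_integrable
    (fun s => hasDerivAt_gaussian_mul_pow X s d) hI (integrable_gaussian_mul_pow X d)⟩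

/-- Integration by parts: add 2i times the vanishing integral of the derivative. For d = 0 the
truncated exponent d - 1 is harmless because its coefficient is 0. -/
theorem integral_gaussian_mul_pow_succ (X : ℝ) (d : ℕ) :
    ∫ s : ℝ, (Real.exp (-s ^ 2 / 4) : ℂ) * ((X : ℂ) - Complex.I * s) ^ (d + 1) =
      X * (∫ s : ℝ, (Real.exp (-s ^ 2 / 4) : ℂ) * ((X : ℂ) - Complex.I * s) ^ d) -
      2 * d * ∫ s : ℝ, (Real.exp (-s ^ 2 / 4) : ℂ) * ((X : ℂ) - Complex.I * s) ^ (d - 1) := by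
  obtain ⟨hI, h0⟩ := integral_deriv_gaussian_mul_pow X d
  have h1 := (integrable_gaussian_mul_pow X d).const_mul (X : ℂ)
  have h2 := (integrable_gaussian_mul_pow X (d - 1)).const_mul (2 * d : ℂ)
  have h3 := hI.const_mul (2 * Complex.I)
  rw [← integral_const_mul, ← integral_const_mul, ← integral_sub h1 h2]
  have h4 := integral_add (h1.sub h2) h3
  rw [integral_const_mul (2 * Complex.I), h0, mul_zero, add_zero] at h4
  refine Eq.trans (integral_congr_ae (Filter.Eventually.of_forall fun s => ?_)) h4
  simp only [Pi.sub_apply]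
  have hi : Complex.I * Complex.I = -1 := Complex.I_mul_I
  linear_combination (2 * d * (Real.exp (-s ^ 2 / 4) : ℂ) * (X - Complex.I * s) ^ (d - 1)) * hi

theorem integral_gaussian_mul_pow (X : ℝ) (d : ℕ) :
    ∫ s : ℝ, (Real.exp (-s ^ 2 / 4) : ℂ) * ((X : ℂ) - Complex.I * s) ^ d =
      (((hermiteH d).eval X : ℝ) : ℂ) * ∫ s : ℝ, (Real.exp (-s ^ 2 / 4) : ℂ) := by
  induction d using Nat.twoStepInduction with
  | zero => simp [hermiteH_zero]
  | one =>
    have := integral_gaussian_mul_pow_succ X 0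
    simpa [hermiteH_one] using this
  | more d h1 h2 =>
    rw [integral_gaussian_mul_pow_succ, h2, Nat.add_sub_cancel, h1, hermiteH_add_two]
    simp only [eval_sub, eval_mul, eval_X, eval_C]
    push_cast
    ring

theorem integral_exp_neg_sq_div_four_ne_zero :
    ∫ s : ℝ, (Real.exp (-s ^ 2 / 4) : ℂ) ≠ 0 := by
  rw [integral_complex_ofReal]
  have := integral_gaussian (1 / 4)
  rw [show (fun x : ℝ => Real.exp (-(1 / 4) * x ^ 2)) = fun s => Real.exp (-s ^ 2 / 4) by
    ext; congr 1; ring] at this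
  rw [this]
  norm_cast
  positivity

end RegularPartition

/-! ### Asymptotics of A_k and δ_k in the unit n^{1/4} -/

namespace RegularPartition

open Filter Topology

theorem ringChoose_succ_mul (a : ℝ) (n : ℕ) :
    Ring.choose a (n + 1) * ((n : ℝ) + 1) = Ring.choose a n * (a - n) := by
  rw [Ring.choose_eq_smul, Ring.choose_eq_smul, descPochhammer_succ_right,
    Polynomial.smeval_mul, Polynomial.smeval_sub, Polynomial.smeval_X, Polynomial.smeval_natCast,
    Nat.factorial_succ]
  simp only [smul_eq_mul]
  push_cast
  have h1 : (n.factorial : ℝ) ≠ 0 := by positivity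
  have h2 : (n : ℝ) + 1 ≠ 0 := by positivity
  simp
  field_simp

theorem abs_ringChoose_half_le (n : ℕ) : |Ring.choose (1 / 2 : ℝ) n| ≤ 1 := by
  induction n with
  | zero => simp
  | succ n ih =>
    have h := ringChoose_succ_mul (1 / 2) n
    have h2 : (0 : ℝ) < (n : ℝ) + 1 := by positivity
    have h3 : |(1 / 2 : ℝ) - n| ≤ (n : ℝ) + 1 := by
      rw [abs_le]; constructor <;> linarith [(Nat.cast_nonneg n : (0 : ℝ) ≤ n)]
    have h4 : |Ring.choose (1 / 2 : ℝ) (n + 1)| * ((n : ℝ) + 1) ≤ 1 * ((n : ℝ) + 1) := by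
      rw [← abs_of_pos h2, ← abs_mul, h, abs_mul, abs_of_pos h2]
      exact mul_le_mul ih h3 (abs_nonneg _) zero_le_one
    exact le_of_mul_le_mul_right h4 h2

theorem ringChoose_half_two : Ring.choose (1 / 2 : ℝ) 2 = -1 / 8 := by
  have h2 := ringChoose_succ_mul (1 / 2) 1
  rw [Ring.choose_one_right] at h2
  norm_num at h2 ⊢
  linarith

theorem tendsto_tsum_ringChoose_half :
    Tendsto (fun n : ℕ => ∑' r : ℕ, Ring.choose (1 / 2 : ℝ) (r + 2) * ((n : ℝ)⁻¹) ^ r) atTop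
      (𝓝 (-1 / 8)) := by
  have hlim : ∑' r : ℕ, (if r = 0 then (-1 / 8 : ℝ) else 0) = -1 / 8 := by
    rw [tsum_ite_eq]
  rw [← hlim]
  have hinv : Tendsto (fun n : ℕ => ((n : ℝ))⁻¹) atTop (𝓝 0) := tendsto_inv_atTop_nhds_zero_nat
  refine tendsto_tsum_of_dominated_convergence (bound := fun r : ℕ => (1 / 2 : ℝ) ^ r)
    (summable_geometric_of_lt_one (by norm_num) (by norm_num)) ?_ ?_
  · intro r
    have := (hinv.pow r).const_mul (Ring.choose (1 / 2 : ℝ) (r + 2))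
    convert this using 2
    split_ifs with h
    · subst h
      rw [zero_add, ringChoose_half_two, pow_zero, mul_one]
    · rw [zero_pow h, mul_zero]
  · filter_upwards [eventually_ge_atTop 2] with n hn r
    have hn' : (2 : ℝ) ≤ n := by exact_mod_cast hn
    rw [norm_mul, norm_pow, Real.norm_eq_abs, norm_inv, Real.norm_natCast]
    calc |Ring.choose (1 / 2 : ℝ) (r + 2)| * ((n : ℝ)⁻¹) ^ r ≤ 1 * (2⁻¹ : ℝ) ^ r := by
          gcongr
          exact abs_ringChoose_half_le _
      _ = (1 / 2 : ℝ) ^ r := by norm_num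

theorem m_pos {k : ℕ} (hk : 2 ≤ k) : 0 < m k := by
  have : (2 : ℝ) ≤ k := by exact_mod_cast hk
  unfold m
  apply div_pos <;> linarith

/-- Factoring n^{-3/2} out of the series leaves a power series in 1/n, whose limit is its constant
term -1/8, the binomial coefficient of 1/2 over 2. -/
theorem delta_eq (k n : ℕ) (hn : 1 ≤ n) :
    delta k n = √(-(2 * (2 * Real.pi * √(m k)) *
      ∑' r : ℕ, Ring.choose (1 / 2 : ℝ) (r + 2) * ((n : ℝ)⁻¹) ^ r)) / √√n ^ 3 := by
  have hn0 : (0 : ℝ) < n := by exact_mod_cast hn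
  have h3 : √√(n : ℝ) ^ 3 = √(√(n : ℝ) ^ 3) := by
    rw [Real.sqrt_eq_rpow (√(n : ℝ)), Real.sqrt_eq_rpow (√(n : ℝ) ^ 3), ← Real.rpow_natCast,
      ← Real.rpow_natCast, ← Real.rpow_mul (by positivity), ← Real.rpow_mul (by positivity)]
    norm_num
  rw [delta, h3, ← Real.sqrt_div']
  · congr 1
    rw [neg_div, ← tsum_mul_left, ← tsum_div_const]
    congr 2
    ext r
    have h4 : (n : ℝ) ^ (((r + 2 : ℕ) : ℝ) - 1 / 2) = (n : ℝ) ^ r * √(n : ℝ) ^ 3 := by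
      rw [Real.sqrt_eq_rpow, ← Real.rpow_natCast, ← Real.rpow_natCast, ← Real.rpow_mul hn0.le,
        ← Real.rpow_add hn0]
      congr 1
      push_cast
      ring
    rw [h4, inv_pow]
    field_simp
    ring
  · positivity

theorem tendsto_sqrt_sqrt_nat : Tendsto (fun n : ℕ => √√(n : ℝ)) atTop atTop :=
  Real.tendsto_sqrt_atTop.comp (Real.tendsto_sqrt_atTop.comp tendsto_natCast_atTop_atTop)

theorem sqrt_sqrt_sq (n : ℕ) : √√(n : ℝ) ^ 2 = √n := Real.sq_sqrt (by positivity)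

theorem sqrt_sqrt_pow_four (n : ℕ) : √√(n : ℝ) ^ 4 = n := by
  rw [show (4 : ℕ) = 2 * 2 by norm_num, pow_mul, sqrt_sqrt_sq, Real.sq_sqrt (by positivity)]

theorem tendsto_delta_mul {k : ℕ} :
    Tendsto (fun n : ℕ => delta k n * √√n ^ 3) atTop (𝓝 √(2 * Real.pi * √(m k) / 4)) := by
  have h := (tendsto_tsum_ringChoose_half.const_mul (2 * (2 * Real.pi * √(m k)))).neg.sqrt
  rw [show -(2 * (2 * Real.pi * √(m k)) * (-1 / 8)) = 2 * Real.pi * √(m k) / 4 by ring] at h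
  refine h.congr' ?_
  filter_upwards [eventually_ge_atTop 1] with n hn
  have hn0 : (0 : ℝ) < n := by exact_mod_cast hn
  rw [delta_eq k n hn, div_mul_cancel₀]
  positivity

theorem A_eq (k d n : ℕ) : A k d n = 2 * Real.pi * √(m k) / √√n ^ 2 +
    3 / 4 * ∑ r ∈ Finset.Icc 1 (3 * d / 4), (-1 : ℝ) ^ r / ((r : ℝ) * (n : ℝ) ^ r) := by
  rw [A, Real.sqrt_div' _ (Nat.cast_nonneg n), sqrt_sqrt_sq, mul_div_assoc]

/-- The correction sum in A_k is O(1/n), below the scale n^{-3/4} of δ_k. It therefore has no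
influence on the limit. -/
theorem tendsto_mul_A_sub (k d : ℕ) :
    Tendsto (fun n : ℕ => √√n ^ 3 * (A k d n - 2 * Real.pi * √(m k) / √√n ^ 2)) atTop (𝓝 0) := by
  have : ∀ n : ℕ, √√n ^ 3 * (A k d n - 2 * Real.pi * √(m k) / √√n ^ 2) =
      3 / 4 * ∑ r ∈ Finset.Icc 1 (3 * d / 4),
        √√n ^ 3 * ((-1 : ℝ) ^ r / ((r : ℝ) * (n : ℝ) ^ r)) := by
    intro n
    rw [A_eq, add_sub_cancel_left, ← Finset.mul_sum]
    ring
  simp_rw [this]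
  rw [show (0 : ℝ) = 3 / 4 * ∑ r ∈ Finset.Icc 1 (3 * d / 4), (0 : ℝ) by simp]
  refine (tendsto_finsetSum _ fun r hr => ?_).const_mul _
  rw [Finset.mem_Icc] at hr
  have h1 : Tendsto (fun n : ℕ => (√√(n : ℝ))⁻¹) atTop (𝓝 0) :=
    tendsto_inv_atTop_zero.comp tendsto_sqrt_sqrt_nat
  have h2 := (h1.pow (4 * r - 3)).const_mul ((-1 : ℝ) ^ r / r)
  rw [zero_pow (by omega), mul_zero] at h2
  refine h2.congr' ?_
  filter_upwards [eventually_ge_atTop 1] with n hn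
  have hn0 : (0 : ℝ) < n := by exact_mod_cast hn
  have hw : 0 < √√(n : ℝ) := by positivity
  have h5 : (n : ℝ) ^ r = √√(n : ℝ) ^ 3 * √√(n : ℝ) ^ (4 * r - 3) := by
    rw [← pow_add, show 3 + (4 * r - 3) = 4 * r by omega, pow_mul, sqrt_sqrt_pow_four]
  rw [h5, inv_pow]
  field_simp

theorem tendsto_sq_mul_A (k d : ℕ) :
    Tendsto (fun n : ℕ => √√n ^ 2 * A k d n) atTop (𝓝 (2 * Real.pi * √(m k))) := by
  have h1 : Tendsto (fun n : ℕ => (√√(n : ℝ))⁻¹) atTop (𝓝 0) :=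
    tendsto_inv_atTop_zero.comp tendsto_sqrt_sqrt_nat
  have h2 := (h1.mul (tendsto_mul_A_sub k d)).const_add (2 * Real.pi * √(m k))
  rw [mul_zero, add_zero] at h2
  refine h2.congr' ?_
  filter_upwards [eventually_ge_atTop 1] with n hn
  have hn0 : (0 : ℝ) < n := by exact_mod_cast hn
  have hw : 0 < √√(n : ℝ) := by positivity
  field_simp
  ring

theorem two_pi_sqrt_m_pos {k : ℕ} (hk : 2 ≤ k) : 0 < 2 * Real.pi * √(m k) := by
  have := m_pos hk
  have := Real.pi_pos
  positivity

theorem eventually_sqrt_sqrt_pos : ∀ᶠ n : ℕ in atTop, 0 < √√(n : ℝ) :=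
  tendsto_sqrt_sqrt_nat.eventually_gt_atTop 0

theorem eventually_A_pos {k : ℕ} (hk : 2 ≤ k) (d : ℕ) : ∀ᶠ n in atTop, 0 < A k d n := by
  filter_upwards [(tendsto_sq_mul_A k d).eventually_const_lt (two_pi_sqrt_m_pos hk)] with n hn
  exact pos_of_mul_pos_right hn (by positivity)

theorem eventually_delta_pos {k : ℕ} (hk : 2 ≤ k) : ∀ᶠ n in atTop, 0 < delta k n := by
  have h : 0 < √(2 * Real.pi * √(m k) / 4) :=
    Real.sqrt_pos.2 (div_pos (two_pi_sqrt_m_pos hk) (by norm_num))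
  filter_upwards [(tendsto_delta_mul (k := k)).eventually_const_lt h] with n hn
  exact pos_of_mul_pos_left hn (by positivity)

theorem tendsto_A (k d : ℕ) : Tendsto (A k d) atTop (𝓝 0) := by
  have h1 : Tendsto (fun n : ℕ => (√√(n : ℝ))⁻¹) atTop (𝓝 0) :=
    tendsto_inv_atTop_zero.comp tendsto_sqrt_sqrt_nat
  have h2 := (h1.pow 2).mul (tendsto_sq_mul_A k d)
  rw [zero_pow two_ne_zero, zero_mul] at h2
  refine h2.congr' ?_
  filter_upwards [eventually_sqrt_sqrt_pos] with n hn
  field_simp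

theorem tendsto_delta_sq_div_A_cube {k : ℕ} (hk : 2 ≤ k) (d : ℕ) :
    Tendsto (fun n => delta k n ^ 2 / A k d n ^ 3) atTop
      (𝓝 (1 / (4 * (2 * Real.pi * √(m k)) ^ 2))) := by
  have hc := two_pi_sqrt_m_pos hk
  have h := ((tendsto_delta_mul (k := k)).pow 2).div ((tendsto_sq_mul_A k d).pow 3)
    (pow_ne_zero 3 hc.ne')
  rw [Real.sq_sqrt (by positivity)] at h
  have e : 2 * Real.pi * √(m k) / 4 / (2 * Real.pi * √(m k)) ^ 3 =
      1 / (4 * (2 * Real.pi * √(m k)) ^ 2) := by field_simp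
  rw [e] at h
  refine h.congr' ?_
  filter_upwards [eventually_sqrt_sqrt_pos, eventually_A_pos hk d] with n hn hA
  simp only [Pi.div_apply]
  field_simp

/-- With w = n^{1/4} and c = 2π√m_k, n - c²/A² = (w²A - c)(w²A + c)/A². Here w²A - c = o(1/w), 1/A²
is of order w⁴ and δ of order w^{-3}, so the powers of w balance and the o(1) survives. -/
theorem tendsto_delta_mul_sub {k : ℕ} (hk : 2 ≤ k) (d : ℕ) :
    Tendsto (fun n : ℕ => delta k n * (n - (2 * Real.pi * √(m k)) ^ 2 / A k d n ^ 2)) atTop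
      (𝓝 0) := by
  have hc := two_pi_sqrt_m_pos hk
  have h1 := (tendsto_sq_mul_A k d).add_const (2 * Real.pi * √(m k))
  have h := (((tendsto_delta_mul (k := k)).mul (tendsto_mul_A_sub k d)).mul h1).div
    ((tendsto_sq_mul_A k d).pow 2) (pow_ne_zero 2 hc.ne')
  rw [mul_zero, zero_mul, zero_div] at h
  refine h.congr' ?_
  filter_upwards [eventually_sqrt_sqrt_pos, eventually_A_pos hk d] with n hn hA
  simp only [Pi.div_apply]
  have h4 := sqrt_sqrt_pow_four n
  set w := √√(n : ℝ)
  rw [← h4]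
  field_simp
  ring

end RegularPartition

/-! ### The Lambert kernel and its decay off the real axis -/

namespace RegularPartition

open Filter Topology

/-- The Lambert-type kernel `∑_{k ∤ a} exp (-a w) = (∑_{0 < j < k} q ^ j) / (1 - q ^ k)`, where
`q = exp (-w)`. -/
noncomputable def kernel (k : ℕ) (w : ℂ) : ℂ :=
  (∑ j ∈ Finset.Ico 1 k, Complex.exp (-w) ^ j) / (1 - Complex.exp (-w) ^ k)

/-- The restriction of `kernel` to the real axis. -/
noncomputable def realKernel (k : ℕ) (u : ℝ) : ℝ :=
  (∑ j ∈ Finset.Ico 1 k, Real.exp (-u) ^ j) / (1 - Real.exp (-u) ^ k)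

theorem kernel_ofReal (k : ℕ) (u : ℝ) : kernel k u = realKernel k u := by
  simp [kernel, realKernel]

theorem norm_exp_neg (w : ℂ) : ‖Complex.exp (-w)‖ = Real.exp (-w.re) := by
  rw [Complex.norm_exp, Complex.neg_re]

theorem exp_neg_pow_lt_one {u : ℝ} (hu : 0 < u) {k : ℕ} (hk : k ≠ 0) : Real.exp (-u) ^ k < 1 :=
  pow_lt_one₀ (Real.exp_pos _).le (Real.exp_lt_one_iff.2 (by linarith)) hk

theorem one_sub_exp_neg_pow_ne_zero {w : ℂ} (hw : 0 < w.re) {k : ℕ} (hk : k ≠ 0) :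
    1 - Complex.exp (-w) ^ k ≠ 0 := by
  intro h
  have h1 : ‖Complex.exp (-w) ^ k‖ = 1 := by rw [← sub_eq_zero.1 h, norm_one]
  rw [norm_pow, norm_exp_neg] at h1
  exact (exp_neg_pow_lt_one hw hk).ne h1

theorem one_sub_le_norm (w : ℂ) (k : ℕ) :
    1 - Real.exp (-w.re) ^ k ≤ ‖1 - Complex.exp (-w) ^ k‖ := by
  have := norm_sub_norm_le (1 : ℂ) (Complex.exp (-w) ^ k)
  rwa [norm_one, norm_pow, norm_exp_neg] at this

theorem norm_kernel_le_div (k : ℕ) (w : ℂ) :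
    ‖kernel k w‖ ≤ (∑ j ∈ Finset.Ico 1 k, Real.exp (-w.re) ^ j) / ‖1 - Complex.exp (-w) ^ k‖ := by
  rw [kernel, norm_div]
  gcongr
  refine (norm_sum_le _ _).trans (Finset.sum_le_sum fun j _ => ?_)
  rw [norm_pow, norm_exp_neg]

theorem norm_kernel_le {k : ℕ} (hk : k ≠ 0) {w : ℂ} (hw : 0 < w.re) :
    ‖kernel k w‖ ≤ realKernel k w.re := by
  refine (norm_kernel_le_div k w).trans ?_
  rw [realKernel]
  have h1 := exp_neg_pow_lt_one hw hk
  refine div_le_div_of_nonneg_left (Finset.sum_nonneg fun _ _ => by positivity) (by linarith)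
    (one_sub_le_norm w k)

/-- This form exhibits the simple pole at the origin, with residue 1 - 1/k. -/
theorem kernel_eq {k : ℕ} (hk : k ≠ 0) {w : ℂ} (hw : 0 < w.re) :
    kernel k w = 1 / (Complex.exp w - 1) - 1 / (Complex.exp (k * w) - 1) := by
  have h1 := one_sub_exp_neg_pow_ne_zero hw hk
  have h2 := one_sub_exp_neg_pow_ne_zero hw one_ne_zero
  rw [pow_one] at h2
  have h3 : Complex.exp w = (Complex.exp (-w))⁻¹ := by rw [Complex.exp_neg, inv_inv]
  have h4 : Complex.exp (k * w) = (Complex.exp (-w) ^ k)⁻¹ := by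
    rw [Complex.exp_nat_mul, h3, inv_pow]
  rw [kernel, h3, h4, geom_sum_Ico' (sub_ne_zero.1 (by simpa using h2)).symm (by omega)]
  have h5 : Complex.exp (-w) ≠ 0 := Complex.exp_ne_zero _
  set q := Complex.exp (-w)
  have h6 : q ^ k ≠ 0 := pow_ne_zero _ h5
  have h7 : q⁻¹ - 1 = (1 - q) / q := by field_simp
  have h8 : (q ^ k)⁻¹ - 1 = (1 - q ^ k) / q ^ k := by field_simp
  rw [h7, h8, one_div_div, one_div_div]
  field_simp
  ring

theorem hasSum_kernel {k : ℕ} (hk : k ≠ 0) {w : ℂ} (hw : 0 < w.re) :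
    HasSum (fun a : ℕ => if k ∣ a then 0 else Complex.exp (-w) ^ a) (kernel k w) := by
  have h1 := one_sub_exp_neg_pow_ne_zero hw hk
  have h2 := one_sub_exp_neg_pow_ne_zero hw one_ne_zero
  rw [pow_one] at h2
  have hq : ‖Complex.exp (-w)‖ < 1 := by
    rw [norm_exp_neg]; exact Real.exp_lt_one_iff.2 (by linarith)
  have hqk : ‖Complex.exp (-w) ^ k‖ < 1 := by
    rw [norm_pow]; exact pow_lt_one₀ (norm_nonneg _) hq hk
  have s1 := hasSum_geometric_of_norm_lt_one hq
  have s2 := hasSum_geometric_of_norm_lt_one hqk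
  have hinj : Function.Injective fun b : ℕ => k * b := mul_right_injective₀ hk
  have s3 : HasSum (fun a : ℕ => if k ∣ a then Complex.exp (-w) ^ a else 0)
      (1 - Complex.exp (-w) ^ k)⁻¹ := by
    rw [← hinj.hasSum_iff]
    · have e : (fun a : ℕ => if k ∣ a then Complex.exp (-w) ^ a else 0) ∘ (fun b : ℕ => k * b) =
          fun b => (Complex.exp (-w) ^ k) ^ b := by
        ext b
        simp [pow_mul]
      rw [e]
      exact s2
    · intro a ha
      rw [if_neg]
      rintro ⟨b, rfl⟩
      exact ha ⟨b, rfl⟩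
  have s4 := s1.sub s3
  have e : (1 - Complex.exp (-w))⁻¹ - (1 - Complex.exp (-w) ^ k)⁻¹ = kernel k w := by
    rw [kernel, geom_sum_Ico' (sub_ne_zero.1 h2).symm (by omega)]
    field_simp
    ring
  rw [e] at s4
  have e2 : (fun a : ℕ => if k ∣ a then 0 else Complex.exp (-w) ^ a) = fun a : ℕ =>
      Complex.exp (-w) ^ a - if k ∣ a then Complex.exp (-w) ^ a else 0 := by
    ext a
    split_ifs <;> simp
  rw [e2]
  exact s4

theorem realKernel_nonneg (k : ℕ) {u : ℝ} (hu : 0 ≤ u) : 0 ≤ realKernel k u := by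
  refine div_nonneg (Finset.sum_nonneg fun _ _ => by positivity) ?_
  rw [sub_nonneg]
  exact pow_le_one₀ (Real.exp_pos _).le (Real.exp_le_one_iff.2 (by linarith))

theorem realKernel_le {k : ℕ} (hk : k ≠ 0) {u : ℝ} (hu : 0 < u) : realKernel k u ≤ 1 / u := by
  have h := kernel_eq hk (w := (u : ℂ)) (by simpa using hu)
  rw [kernel_ofReal] at h
  have h' : realKernel k u = 1 / (Real.exp u - 1) - 1 / (Real.exp (k * u) - 1) := by
    exact_mod_cast h
  have h1 : u ≤ Real.exp u - 1 := by linarith [Real.add_one_le_exp u]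
  have h2 : 0 ≤ 1 / (Real.exp (k * u) - 1) := by
    apply div_nonneg zero_le_one
    rw [sub_nonneg]
    exact Real.one_le_exp (by positivity)
  have h3 : 1 / (Real.exp u - 1) ≤ 1 / u := one_div_le_one_div_of_le hu h1
  linarith

theorem one_sub_exp_neg_pow_le (k : ℕ) (u : ℝ) : 1 - Real.exp (-u) ^ k ≤ k * u := by
  rw [← Real.exp_nat_mul]
  have := Real.add_one_le_exp (k * -u)
  linarith

theorem le_realKernel {k : ℕ} (hk : 2 ≤ k) {u : ℝ} (hu : 0 < u) (hu1 : u ≤ 1) :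
    Real.exp (-1) / (k * u) ≤ realKernel k u := by
  have h1 := exp_neg_pow_lt_one hu (by omega : k ≠ 0)
  have h2 : Real.exp (-1) ≤ ∑ j ∈ Finset.Ico 1 k, Real.exp (-u) ^ j := by
    calc Real.exp (-1) ≤ Real.exp (-u) ^ 1 := by rw [pow_one]; gcongr
      _ ≤ _ := Finset.single_le_sum (f := fun j => Real.exp (-u) ^ j)
        (fun _ _ => by positivity) (Finset.mem_Ico.2 ⟨le_rfl, by omega⟩)
  exact div_le_div₀ ((Real.exp_pos _).le.trans h2) h2 (by linarith) (one_sub_exp_neg_pow_le k u)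

/-- Since 2(1 - cos u) = |e^{iu} - 1|², this is the triangle inequality for |e^{iu} - 1|, squared.
-/
theorem one_sub_cos_add_le (u v : ℝ) :
    1 - Real.cos (u + v) ≤ 2 * (1 - Real.cos u) + 2 * (1 - Real.cos v) := by
  rw [Real.cos_add]
  nlinarith [Real.sin_sq_add_cos_sq u, Real.sin_sq_add_cos_sq v, sq_nonneg (Real.sin u - Real.sin v),
    sq_nonneg (Real.cos u - Real.cos v), sq_nonneg (Real.sin u + Real.sin v),
    sq_nonneg (Real.cos u + Real.cos v - 2), Real.cos_le_one u, Real.cos_le_one v]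

theorem abs_sin_nat_mul_le (b : ℕ) (φ : ℝ) : |Real.sin (b * φ)| ≤ b * |Real.sin φ| := by
  induction b with
  | zero => simp
  | succ b ih =>
    push_cast
    rw [add_mul, one_mul, Real.sin_add]
    refine (abs_add_le _ _).trans ?_
    rw [abs_mul, abs_mul, add_mul, one_mul]
    refine add_le_add ?_ ?_
    · calc _ ≤ |Real.sin (b * φ)| * 1 := by gcongr; exact Real.abs_cos_le_one _
        _ ≤ _ := by linarith
    · calc _ ≤ 1 * |Real.sin φ| := by gcongr; exact Real.abs_cos_le_one _
        _ = _ := one_mul _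

theorem one_sub_cos_eq (ψ : ℝ) : 1 - Real.cos ψ = 2 * Real.sin (ψ / 2) ^ 2 := by
  have := Real.cos_sq_add_sin_sq (ψ / 2)
  have h := Real.cos_two_mul (ψ / 2)
  rw [mul_div_cancel₀ ψ two_ne_zero] at h
  rw [h]; linarith

theorem one_sub_cos_nat_mul_le (b : ℕ) (ψ : ℝ) :
    1 - Real.cos (b * ψ) ≤ (b : ℝ) ^ 2 * (1 - Real.cos ψ) := by
  rw [one_sub_cos_eq, one_sub_cos_eq, mul_div_assoc, ← sq_abs, ← sq_abs (Real.sin (ψ / 2))]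
  have h := pow_le_pow_left₀ (abs_nonneg _) (abs_sin_nat_mul_le b (ψ / 2)) 2
  rw [mul_pow] at h
  linarith

theorem two_div_pi_sq_mul_sq_le {ψ : ℝ} (h : |ψ| ≤ Real.pi) :
    2 / Real.pi ^ 2 * ψ ^ 2 ≤ 1 - Real.cos ψ := by
  linarith [Real.cos_le_one_sub_mul_cos_sq h]

theorem normSq_one_sub (k : ℕ) (x θ : ℝ) :
    ‖1 - Complex.exp (-(x + θ * Complex.I)) ^ k‖ ^ 2 =
      (1 - Real.exp (-x) ^ k) ^ 2 + 2 * Real.exp (-x) ^ k * (1 - Real.cos (k * θ)) := by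
  have h : Complex.exp (-(x + θ * Complex.I)) ^ k =
      (Real.exp (-x) ^ k : ℝ) * (Complex.cos ((k * θ : ℝ)) - Complex.sin ((k * θ : ℝ)) * Complex.I) := by
    rw [← Complex.exp_nat_mul, ← Real.exp_nat_mul, Complex.ofReal_exp,
      ← Complex.cos_neg, ← neg_neg (Complex.sin _), ← Complex.sin_neg, neg_mul, sub_neg_eq_add,
      ← Complex.exp_mul_I, ← Complex.exp_add]
    congr 1
    push_cast
    ring
  rw [h, Complex.sq_norm, Complex.normSq_apply, ← Complex.ofReal_cos, ← Complex.ofReal_sin]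
  simp only [Complex.sub_re, Complex.sub_im, Complex.mul_re, Complex.mul_im, Complex.ofReal_re,
    Complex.ofReal_im, Complex.one_re, Complex.one_im, Complex.I_re, Complex.I_im]
  linear_combination (Real.exp (-x) ^ k) ^ 2 * Real.sin_sq_add_cos_sq (k * θ)

/-- The numerator of the kernel never exceeds its value at x in modulus, so growth of the
denominator is pure gain. The constants come from √(1 + τ) ≥ 1 + τ/3 and 1/(1 + τ/3) ≤ 1 - τ/4 on
[0, 1]. -/
theorem realKernel_sub_re_kernel_ge {k : ℕ} (hk : k ≠ 0) {x θ τ : ℝ} (hx : 0 < x) (hτ : 0 ≤ τ)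
    (hτ1 : τ ≤ 1) (h : (1 - Real.exp (-x) ^ k) ^ 2 * (1 + τ) ≤
      ‖1 - Complex.exp (-(x + θ * Complex.I)) ^ k‖ ^ 2) :
    realKernel k x * (τ / 4) ≤ realKernel k x - (kernel k (x + θ * Complex.I)).re := by
  have hR := exp_neg_pow_lt_one hx hk
  have hre : ((x : ℂ) + θ * Complex.I).re = x := by simp
  have h1 := (Complex.re_le_norm _).trans (norm_kernel_le_div k (x + θ * Complex.I))
  rw [hre] at h1
  have h2 : (1 - Real.exp (-x) ^ k) * (1 + τ / 3) ≤
      ‖1 - Complex.exp (-(x + θ * Complex.I)) ^ k‖ := by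
    refine (sq_le_sq₀ (mul_nonneg (by linarith) (by linarith)) (norm_nonneg _)).1 ?_
    refine le_trans ?_ h
    rw [mul_pow]
    gcongr
    nlinarith
  have hN : 0 ≤ ∑ j ∈ Finset.Ico 1 k, Real.exp (-x) ^ j :=
    Finset.sum_nonneg fun _ _ => by positivity
  have h3 : (kernel k (x + θ * Complex.I)).re ≤ realKernel k x / (1 + τ / 3) := by
    refine h1.trans ?_
    rw [realKernel, div_div]
    refine div_le_div_of_nonneg_left hN ?_ h2
    have : 0 < 1 - Real.exp (-x) ^ k := by linarith
    positivity
  have h4 : realKernel k x / (1 + τ / 3) ≤ realKernel k x * (1 - τ / 4) := by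
    rw [div_le_iff₀ (by positivity), mul_assoc]
    refine le_mul_of_one_le_right (realKernel_nonneg k hx.le) ?_
    nlinarith
  linarith

theorem hasSum_realKernel_sub_re_kernel {k : ℕ} (hk : k ≠ 0) {x : ℝ} (hx : 0 < x) (θ : ℝ) :
    HasSum (fun a : ℕ => if k ∣ a then 0 else Real.exp (-x) ^ a * (1 - Real.cos (a * θ)))
      (realKernel k x - (kernel k (x + θ * Complex.I)).re) := by
  have h1 := Complex.hasSum_re (hasSum_kernel hk (w := (x : ℂ)) (by simpa using hx))
  have h2 := Complex.hasSum_re (hasSum_kernel hk (w := (x : ℂ) + θ * Complex.I) (by simpa using hx))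
  have h3 := h1.sub h2
  rw [kernel_ofReal, Complex.ofReal_re] at h3
  have e : ∀ a : ℕ, (Complex.exp (-((x : ℂ) + θ * Complex.I)) ^ a).re =
      Real.exp (-x) ^ a * Real.cos (a * θ) := by
    intro a
    rw [← Complex.exp_nat_mul, Complex.exp_re, ← Real.exp_nat_mul]
    simp
  have e' : ∀ a : ℕ, (Complex.exp (-(x : ℂ)) ^ a).re = Real.exp (-x) ^ a := by
    intro a
    rw [← Complex.ofReal_neg, ← Complex.ofReal_exp, ← Complex.ofReal_pow, Complex.ofReal_re]
  have e2 : (fun a : ℕ => if k ∣ a then 0 else Real.exp (-x) ^ a * (1 - Real.cos (a * θ))) =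
      fun a : ℕ => (if k ∣ a then 0 else Complex.exp (-(x : ℂ)) ^ a).re -
        (if k ∣ a then 0 else Complex.exp (-((x : ℂ) + θ * Complex.I)) ^ a).re := by
    ext a
    split_ifs
    · simp
    · rw [e, e']; ring
  rw [e2]
  exact h3

/-- The case where the denominator gives no gain: kθ is then within O(x) of a multiple of 2π
although θ is not near one. For a = kb + 1 with bx ≤ 1 the angle aθ stays close to θ modulo 2π, so
about 1/x terms of the series for the difference are each bounded below. -/
theorem kernel_gap_of_far {k : ℕ} (hk : 2 ≤ k) {x θ : ℝ} (hx : 0 < x) (hx1 : x ≤ 1)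
    (h1 : Real.pi / k ≤ |θ|) (h2 : |θ| ≤ Real.pi)
    (h : ‖1 - Complex.exp (-(x + θ * Complex.I)) ^ k‖ ^ 2 <
      (1 - Real.exp (-x) ^ k) ^ 2 * (1 + Real.exp (-k) / k ^ 4)) :
    Real.exp (-(k + 1)) / (2 * k ^ 2) / x ≤
      realKernel k x - (kernel k (x + θ * Complex.I)).re := by
  have hk0 : (0 : ℝ) < k := by positivity
  have hkx : Real.exp (-k) ≤ Real.exp (-x) ^ k := by
    rw [← Real.exp_nat_mul, Real.exp_le_exp]
    nlinarith
  have hcos : 1 - Real.cos (k * θ) ≤ 1 / (2 * k ^ 2) * x ^ 2 := by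
    rw [normSq_one_sub, mul_add, mul_one, add_lt_add_iff_left] at h
    have h3 : (1 - Real.exp (-x) ^ k) ^ 2 ≤ (k * x) ^ 2 :=
      pow_le_pow_left₀ (sub_nonneg.2 (exp_neg_pow_lt_one hx (by omega)).le)
        (one_sub_exp_neg_pow_le k x) 2
    have h4 : 2 * Real.exp (-k) * (1 - Real.cos (k * θ)) ≤
        (k * x) ^ 2 * (Real.exp (-k) / k ^ 4) := by
      have h5 : 0 ≤ 1 - Real.cos (k * θ) := by linarith [Real.cos_le_one (k * θ)]
      calc _ ≤ 2 * Real.exp (-x) ^ k * (1 - Real.cos (k * θ)) := by gcongr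
        _ ≤ _ := h.le
        _ ≤ _ := by gcongr
    have h6 := Real.exp_pos (-(k : ℝ))
    have h7 : (k * x) ^ 2 * (Real.exp (-k) / k ^ 4) =
        2 * Real.exp (-k) * (1 / (2 * k ^ 2) * x ^ 2) := by field_simp
    rw [h7] at h4
    exact le_of_mul_le_mul_left h4 (by positivity)
  have hθ : 2 / (k : ℝ) ^ 2 ≤ 1 - Real.cos θ := by
    refine le_trans ?_ (two_div_pi_sq_mul_sq_le h2)
    have h3 : (Real.pi / k) ^ 2 ≤ θ ^ 2 := by
      rw [← sq_abs θ]; exact pow_le_pow_left₀ (by positivity) h1 2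
    calc 2 / (k : ℝ) ^ 2 = 2 / Real.pi ^ 2 * (Real.pi / k) ^ 2 := by
          have := Real.pi_pos; field_simp
      _ ≤ _ := by gcongr
  have hterm : ∀ b : ℕ, (b : ℝ) * x ≤ 1 → Real.exp (-(k + 1)) / (2 * k ^ 2) ≤
      Real.exp (-x) ^ (k * b + 1) * (1 - Real.cos (((k * b + 1 : ℕ) : ℝ) * θ)) := by
    intro b hb
    have h3 := one_sub_cos_add_le (((k * b + 1 : ℕ) : ℝ) * θ) (-(b * (k * θ)))
    rw [show ((k * b + 1 : ℕ) : ℝ) * θ + -(b * (k * θ)) = θ by push_cast; ring, Real.cos_neg] at h3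
    have h4 := one_sub_cos_nat_mul_le b (k * θ)
    have h5 : (b : ℝ) ^ 2 * (1 - Real.cos (k * θ)) ≤ 1 / (2 * k ^ 2) := by
      calc _ ≤ (b : ℝ) ^ 2 * (1 / (2 * k ^ 2) * x ^ 2) := by gcongr
        _ = 1 / (2 * k ^ 2) * (b * x) ^ 2 := by ring
        _ ≤ 1 / (2 * k ^ 2) * 1 := by gcongr; exact pow_le_one₀ (by positivity) hb
        _ = _ := mul_one _
    have h6 : 1 / (2 * (k : ℝ) ^ 2) ≤ 1 - Real.cos (((k * b + 1 : ℕ) : ℝ) * θ) := by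
      -- From 2/k² ≤ 1 - cos θ ≤ 2(1 - cos aθ) + 2 · 1/(2k²) with a = kb + 1.
      have : 2 / (k : ℝ) ^ 2 = 4 * (1 / (2 * k ^ 2)) := by field_simp; norm_num
      linarith
    have h7 : Real.exp (-(k + 1)) ≤ Real.exp (-x) ^ (k * b + 1) := by
      rw [← Real.exp_nat_mul, Real.exp_le_exp]
      push_cast
      nlinarith
    rw [div_eq_mul_one_div]
    exact mul_le_mul h7 h6 (by positivity) (by positivity)
  have hsum := sum_le_hasSum ((Finset.range (⌊1 / x⌋₊ + 1)).image fun b => k * b + 1)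
    (fun a _ => ?_) (hasSum_realKernel_sub_re_kernel (by omega : k ≠ 0) hx θ)
  · refine le_trans ?_ hsum
    rw [Finset.sum_image (fun a _ b _ hab => by
      have := Nat.add_right_cancel hab
      exact Nat.eq_of_mul_eq_mul_left (by omega) this)]
    calc Real.exp (-(k + 1)) / (2 * k ^ 2) / x
        ≤ (⌊1 / x⌋₊ + 1) * (Real.exp (-(k + 1)) / (2 * k ^ 2)) := by
          rw [div_eq_mul_one_div _ x, mul_comm]
          gcongr
          exact (Nat.lt_floor_add_one _).le
      _ = ∑ b ∈ Finset.range (⌊1 / x⌋₊ + 1), Real.exp (-(k + 1)) / (2 * k ^ 2) := by simp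
      _ ≤ _ := by
          refine Finset.sum_le_sum fun b hb => ?_
          rw [if_neg]
          · refine hterm b ?_
            have h3 : (b : ℝ) ≤ ⌊1 / x⌋₊ := by
              exact_mod_cast Nat.lt_succ_iff.1 (Finset.mem_range.1 hb)
            rw [← le_div_iff₀ hx]
            exact h3.trans (Nat.floor_le (by positivity))
          · intro hd
            have := (Nat.dvd_add_right (dvd_mul_right k b)).1 hd
            have := Nat.le_of_dvd one_pos this
            omega
  · split_ifs
    · exact le_rfl
    · have := Real.cos_le_one (a * θ)
      have : 0 ≤ 1 - Real.cos (a * θ) := by linarith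
      positivity

/-- The constants c1, c2, c3 serve three regimes: |kθ| ≤ π, where 1 - cos kθ is at least quadratic
in kθ; larger θ with |1 - q^k| visibly enlarged; and θ near a nonzero multiple of 2π/k. -/
theorem exists_kernel_gap {k : ℕ} (hk : 2 ≤ k) : ∃ c : ℝ, 0 < c ∧ ∀ x θ : ℝ, 0 < x → x ≤ 1 →
    |θ| ≤ Real.pi → c / x * min 1 ((θ / x) ^ 2) ≤
      realKernel k x - (kernel k (x + θ * Complex.I)).re := by
  have hk0 : (0 : ℝ) < k := by positivity
  have hk2 : (2 : ℝ) ≤ k := by exact_mod_cast hk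
  have hpi := Real.pi_pos
  set e := Real.exp (-(k : ℝ)) with he
  have he0 : 0 < e := Real.exp_pos _
  have he1 : e ≤ 1 := Real.exp_le_one_iff.2 (by linarith)
  set κ := 4 * e / Real.pi ^ 2 with hκ
  have hκ0 : 0 < κ := by positivity
  have hκ1 : κ ≤ 1 := by
    rw [hκ, div_le_one (by positivity)]
    nlinarith [Real.pi_gt_three]
  set c1 := Real.exp (-1) / k * (κ / 4) with hc1
  set c2 := Real.exp (-1) / k * (e / k ^ 4 / 4) with hc2
  set c3 := Real.exp (-(k + 1 : ℝ)) / (2 * k ^ 2) with hc3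
  have hc1p : 0 < c1 := by positivity
  have hc2p : 0 < c2 := by positivity
  have hc3p : 0 < c3 := by positivity
  refine ⟨min c1 (min c2 c3), by positivity, fun x θ hx hx1 hθ => ?_⟩
  have hmin0 : 0 ≤ min 1 ((θ / x) ^ 2) := by positivity
  have hmin1 : min 1 ((θ / x) ^ 2) ≤ 1 := min_le_left _ _
  have hker := le_realKernel hk hx hx1
  rw [← div_div] at hker
  rcases le_total |θ| (Real.pi / k) with h1 | h1
  · have hgap := realKernel_sub_re_kernel_ge (by omega : k ≠ 0) (θ := θ) hx
      (mul_nonneg hκ0.le hmin0) (mul_le_one₀ hκ1 hmin0 hmin1) ?_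
    · refine le_trans ?_ hgap
      calc _ ≤ c1 / x * min 1 ((θ / x) ^ 2) := by gcongr; exact min_le_left _ _
        _ = Real.exp (-1) / k / x * (κ * min 1 ((θ / x) ^ 2) / 4) := by rw [hc1]; ring
        _ ≤ _ := by gcongr
    · rw [normSq_one_sub, mul_add, mul_one, add_le_add_iff_left]
      have h2 : |(k : ℝ) * θ| ≤ Real.pi := by
        rw [abs_mul, Nat.abs_cast]
        rw [le_div_iff₀ hk0] at h1
        linarith
      have h3 := two_div_pi_sq_mul_sq_le h2
      have h4 : (1 - Real.exp (-x) ^ k) ^ 2 ≤ (k * x) ^ 2 :=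
        pow_le_pow_left₀ (sub_nonneg.2 (exp_neg_pow_lt_one hx (by omega)).le)
          (one_sub_exp_neg_pow_le k x) 2
      have hkx : e ≤ Real.exp (-x) ^ k := by
        rw [← Real.exp_nat_mul, Real.exp_le_exp]
        nlinarith
      calc _ ≤ (k * x) ^ 2 * (κ * (θ / x) ^ 2) := by gcongr; exact min_le_right _ _
        _ = 2 * e * (2 / Real.pi ^ 2 * (k * θ) ^ 2) := by rw [hκ]; field_simp; ring
        _ ≤ _ := by gcongr
  · rcases lt_or_ge (‖1 - Complex.exp (-(x + θ * Complex.I)) ^ k‖ ^ 2)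
      ((1 - Real.exp (-x) ^ k) ^ 2 * (1 + e / k ^ 4)) with h2 | h2
    · refine le_trans ?_ (kernel_gap_of_far hk hx hx1 h1 hθ h2)
      calc _ ≤ c3 / x * 1 := by
            gcongr
            exact (min_le_right _ _).trans (min_le_right _ _)
        _ = _ := mul_one _
    · have hgap := realKernel_sub_re_kernel_ge (by omega : k ≠ 0) (θ := θ) hx
        (by positivity) ?_ h2
      · refine le_trans ?_ hgap
        calc _ ≤ c2 / x * 1 := by
              gcongr
              exact (min_le_right _ _).trans (min_le_left _ _)
          _ = Real.exp (-1) / k / x * (e / k ^ 4 / 4) := by rw [hc2]; ring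
          _ ≤ _ := by gcongr
      · rw [div_le_one (by positivity)]
        exact he1.trans (one_le_pow₀ (by linarith))

end RegularPartition

/-! ### The generating function and its logarithm -/

namespace RegularPartition

open Filter Topology

/-- The logarithm of the generating function of `k`-regular partitions at `exp (-z)`. -/
noncomputable def logGen (k : ℕ) (z : ℂ) : ℂ :=
  ∑' r : ℕ, kernel k (((r : ℂ) + 1) * z) / ((r : ℂ) + 1)

theorem natCast_succ_mul_re (r : ℕ) (z : ℂ) : (((r : ℂ) + 1) * z).re = ((r : ℝ) + 1) * z.re := by
  have : ((r : ℂ) + 1) = (((r : ℝ) + 1 : ℝ) : ℂ) := by push_cast; rfl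
  rw [this, Complex.re_ofReal_mul]

theorem norm_natCast_succ (r : ℕ) : ‖(r : ℂ) + 1‖ = (r : ℝ) + 1 := by
  have : ((r : ℂ) + 1) = (((r : ℝ) + 1 : ℝ) : ℂ) := by push_cast; rfl
  rw [this, Complex.norm_real, Real.norm_of_nonneg (by positivity)]

theorem summable_inv_natCast_succ_sq_mul (x : ℝ) :
    Summable fun r : ℕ => 1 / (((r : ℝ) + 1) ^ 2 * x) := by
  have h := (summable_nat_add_iff 1).2 (Real.summable_one_div_nat_pow.2 one_lt_two)
  refine (h.mul_right (1 / x)).congr fun r => ?_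
  push_cast
  rw [one_div_mul_one_div]

theorem realKernel_div_le {k : ℕ} (hk : k ≠ 0) {x : ℝ} (hx : 0 < x) (r : ℕ) :
    realKernel k (((r : ℝ) + 1) * x) / ((r : ℝ) + 1) ≤ 1 / (((r : ℝ) + 1) ^ 2 * x) := by
  have h := realKernel_le hk (u := ((r : ℝ) + 1) * x) (by positivity)
  calc _ ≤ 1 / (((r : ℝ) + 1) * x) / ((r : ℝ) + 1) := by gcongr
    _ = _ := by rw [div_div]; ring

theorem norm_logGen_term_le {k : ℕ} (hk : k ≠ 0) {z : ℂ} (hz : 0 < z.re) (r : ℕ) :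
    ‖kernel k (((r : ℂ) + 1) * z) / ((r : ℂ) + 1)‖ ≤ 1 / (((r : ℝ) + 1) ^ 2 * z.re) := by
  refine le_trans ?_ (realKernel_div_le hk hz r)
  rw [norm_div, norm_natCast_succ]
  gcongr
  have h := norm_kernel_le hk (w := ((r : ℂ) + 1) * z)
    (by rw [natCast_succ_mul_re]; positivity)
  rwa [natCast_succ_mul_re] at h

theorem summable_logGen {k : ℕ} (hk : k ≠ 0) {z : ℂ} (hz : 0 < z.re) :
    Summable fun r : ℕ => kernel k (((r : ℂ) + 1) * z) / ((r : ℂ) + 1) :=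
  Summable.of_norm_bounded (summable_inv_natCast_succ_sq_mul z.re) (norm_logGen_term_le hk hz)

/-- In every term of the series the real part is largest on the real axis, so all terms of the
difference are nonnegative and the one with r = 0 can be kept alone. -/
theorem logGen_gap {k : ℕ} (hk : k ≠ 0) {x : ℝ} (hx : 0 < x) (θ : ℝ) :
    realKernel k x - (kernel k (x + θ * Complex.I)).re ≤
      (logGen k x).re - (logGen k (x + θ * Complex.I)).re := by
  have hre : ((x : ℂ) + θ * Complex.I).re = x := by simp
  have h1 := Complex.hasSum_re (summable_logGen hk (z := (x : ℂ)) (by simpa using hx)).hasSum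
  have h2 := Complex.hasSum_re
    (summable_logGen hk (z := (x : ℂ) + θ * Complex.I) (by simpa using hx)).hasSum
  have h3 := le_hasSum (h1.sub h2) 0 fun r _ => ?_
  · simpa [kernel_ofReal, logGen] using h3
  · have hc : ((r : ℂ) + 1) = (((r : ℝ) + 1 : ℝ) : ℂ) := by push_cast; rfl
    rw [hc, ← Complex.ofReal_mul, kernel_ofReal, Complex.div_ofReal_re, Complex.div_ofReal_re,
      ← sub_div, Complex.ofReal_re]
    refine div_nonneg (sub_nonneg.2 ?_) (by positivity)
    refine (Complex.re_le_norm _).trans ?_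
    have h := norm_kernel_le hk (w := (((r : ℝ) + 1 : ℝ) : ℂ) * (x + θ * Complex.I))
      (by rw [Complex.re_ofReal_mul, hre]; positivity)
    rwa [Complex.re_ofReal_mul, hre] at h

theorem continuous_logGen {k : ℕ} (hk : k ≠ 0) {x : ℝ} (hx : 0 < x) :
    Continuous fun θ : ℝ => logGen k (x + θ * Complex.I) := by
  unfold logGen
  refine continuous_tsum (fun r => ?_) (summable_inv_natCast_succ_sq_mul x) fun r θ => ?_
  · refine Continuous.div_const ?_ _
    unfold kernel
    refine Continuous.div (by fun_prop) (by fun_prop) fun θ => ?_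
    refine one_sub_exp_neg_pow_ne_zero ?_ hk
    rw [natCast_succ_mul_re]
    simp only [Complex.add_re, Complex.ofReal_re, Complex.re_ofReal_mul, Complex.I_re, mul_zero,
      add_zero]
    positivity
  · have h := norm_logGen_term_le hk (z := (x : ℂ) + θ * Complex.I) (by simpa using hx) r
    simpa using h

theorem hasSum_realKernel {k : ℕ} (hk : k ≠ 0) {u : ℝ} (hu : 0 < u) :
    HasSum (fun a : ℕ => if k ∣ a then 0 else Real.exp (-u) ^ a) (realKernel k u) := by
  have h := hasSum_kernel hk (w := (u : ℂ)) (by simpa using hu)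
  rw [kernel_ofReal] at h
  rw [← Complex.hasSum_ofReal]
  have e : (fun a : ℕ => (((if k ∣ a then 0 else Real.exp (-u) ^ a : ℝ)) : ℂ)) =
      fun a : ℕ => if k ∣ a then 0 else Complex.exp (-(u : ℂ)) ^ a := by
    ext a
    split_ifs <;> simp
  rw [e]
  exact h

/-- The number of `k`-regular partitions of `n` with all parts at most `N`. -/
def boundedCount (k N n : ℕ) : ℕ :=
  (Nat.Partition.restricted n (fun i => ¬ k ∣ i ∧ i ≤ N)).card

theorem boundedCount_le (k N n : ℕ) : boundedCount k N n ≤ regularCount k n := by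
  refine Finset.card_le_card fun p hp => ?_
  simp only [Nat.Partition.restricted, Finset.mem_filter, Finset.mem_univ, true_and] at hp ⊢
  exact fun i hi => (hp i hi).1

theorem boundedCount_eq (k : ℕ) {N n : ℕ} (h : n ≤ N) : boundedCount k N n = regularCount k n := by
  refine le_antisymm (boundedCount_le k N n) (Finset.card_le_card fun p hp => ?_)
  simp only [Nat.Partition.restricted, Finset.mem_filter, Finset.mem_univ, true_and] at hp ⊢
  exact fun i hi => ⟨hp i hi, (Nat.Partition.le_of_mem_parts hi).trans h⟩

section PowerSeriesEval
open PowerSeries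

/-- The power series `φ` converges absolutely at `q`, with sum `v`. -/
def HasEval (φ : PowerSeries ℂ) (q v : ℂ) : Prop :=
  (Summable fun n => ‖coeff n φ * q ^ n‖) ∧ HasSum (fun n => coeff n φ * q ^ n) v

theorem HasEval.one (q : ℂ) : HasEval 1 q 1 := by
  have h : ∀ n ∉ ({0} : Finset ℕ), coeff n (1 : PowerSeries ℂ) * q ^ n = 0 := by
    intro n hn
    rw [coeff_one, if_neg (by simpa using hn), zero_mul]
  constructor
  · exact summable_of_ne_finset_zero (s := {0}) fun n hn => by rw [h n hn, norm_zero]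
  · have := hasSum_sum_of_ne_finset_zero (L := .unconditional ℕ) h
    simpa using this

theorem HasEval.mul {φ ψ : PowerSeries ℂ} {q v w : ℂ} (hφ : HasEval φ q v) (hψ : HasEval ψ q w) :
    HasEval (φ * ψ) q (v * w) := by
  have e : ∀ n, coeff n (φ * ψ) * q ^ n = ∑ p ∈ Finset.HasAntidiagonal.antidiagonal n,
      (coeff p.1 φ * q ^ p.1) * (coeff p.2 ψ * q ^ p.2) := by
    intro n
    rw [coeff_mul, Finset.sum_mul]
    refine Finset.sum_congr rfl fun p hp => ?_
    rw [← Finset.HasAntidiagonal.mem_antidiagonal.1 hp, pow_add]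
    ring
  have hs := summable_norm_sum_mul_antidiagonal_of_summable_norm hφ.1 hψ.1
  constructor
  · simpa only [e] using hs
  · simp only [e]
    rw [← hφ.2.tsum_eq, ← hψ.2.tsum_eq,
      tsum_mul_tsum_eq_tsum_sum_antidiagonal_of_summable_norm hφ.1 hψ.1]
    exact hs.of_norm.hasSum

theorem HasEval.prod {ι : Type*} (s : Finset ι) {φ : ι → PowerSeries ℂ} {q : ℂ} {v : ι → ℂ}
    (h : ∀ i ∈ s, HasEval (φ i) q (v i)) : HasEval (∏ i ∈ s, φ i) q (∏ i ∈ s, v i) := by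
  classical
  induction s using Finset.induction_on with
  | empty => simpa using HasEval.one q
  | insert i s hi ih =>
    rw [Finset.prod_insert hi, Finset.prod_insert hi]
    exact (h i (Finset.mem_insert_self i s)).mul (ih fun j hj => h j (Finset.mem_insert_of_mem hj))

open PowerSeries.WithPiTopology in
theorem hasEval_tsum_X_pow {a : ℕ} (ha : a ≠ 0) {q : ℂ} (hq : ‖q‖ < 1) :
    HasEval (∑' j : ℕ, (X : PowerSeries ℂ) ^ (a * j)) q (1 - q ^ a)⁻¹ := by
  have hs : Summable fun j : ℕ => (X : PowerSeries ℂ) ^ (a * j) := by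
    simp_rw [pow_mul]
    exact summable_pow_of_constantCoeff_eq_zero (by simp [ha])
  have hc : ∀ n, coeff n (∑' j : ℕ, (X : PowerSeries ℂ) ^ (a * j)) = if a ∣ n then 1 else 0 := by
    intro n
    rw [hs.map_tsum _ (continuous_coeff _ n)]
    simp only [coeff_X_pow]
    split_ifs with h
    · obtain ⟨b, rfl⟩ := h
      rw [tsum_eq_single b]
      · simp
      · intro b' hb'
        rw [if_neg]
        intro h
        exact hb' (Nat.eq_of_mul_eq_mul_left (Nat.pos_of_ne_zero ha) h).symm
    · have e : ∀ j : ℕ, (if n = a * j then (1 : ℂ) else 0) = 0 := by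
        intro j
        rw [if_neg]
        rintro rfl
        exact h (dvd_mul_right a j)
      simp only [e, tsum_zero]
  have hqa : ‖q ^ a‖ < 1 := by
    rw [norm_pow]; exact pow_lt_one₀ (norm_nonneg _) hq ha
  have hinj : Function.Injective fun b : ℕ => a * b := mul_right_injective₀ ha
  constructor
  · refine Summable.of_nonneg_of_le (fun _ => norm_nonneg _) (fun n => ?_)
      (summable_geometric_of_lt_one (norm_nonneg _) hq)
    rw [hc, norm_mul, norm_pow]
    split_ifs <;> simp
  · rw [← hinj.hasSum_iff]
    · have e : (fun n => coeff n (∑' j : ℕ, (X : PowerSeries ℂ) ^ (a * j)) * q ^ n) ∘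
          (fun b : ℕ => a * b) = fun b => (q ^ a) ^ b := by
        ext b
        rw [Function.comp_apply, hc, if_pos (dvd_mul_right a b), one_mul, pow_mul]
      rw [e]
      exact hasSum_geometric_of_norm_lt_one hqa
    · intro n hn
      rw [hc, if_neg, zero_mul]
      rintro ⟨b, rfl⟩
      exact hn ⟨b, rfl⟩

open PowerSeries.WithPiTopology in
theorem mk_boundedCount (k N : ℕ) :
    PowerSeries.mk (fun n => (boundedCount k N n : ℂ)) = ∏ i ∈ Finset.range N,
      if ¬ k ∣ i + 1 then ∑' j : ℕ, (X : PowerSeries ℂ) ^ ((i + 1) * j) else 1 := by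
  have h1 := Nat.Partition.hasProd_powerSeriesMk_card_restricted ℂ (fun i => ¬ k ∣ i ∧ i ≤ N)
  have h2 := hasProd_prod_of_ne_finset_one (L := .unconditional ℕ) (s := Finset.range N)
    (f := fun i => if ¬ k ∣ i + 1 ∧ i + 1 ≤ N then
      ∑' j : ℕ, (X : PowerSeries ℂ) ^ ((i + 1) * j) else 1) (fun i hi => ?_)
  · refine (h1.unique h2).trans (Finset.prod_congr rfl fun i hi => ?_)
    have := Finset.mem_range.1 hi
    simp only [show i + 1 ≤ N by omega, and_true]
  · rw [Finset.mem_range] at hi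
    rw [if_neg (by omega)]

theorem hasEval_boundedCount (k N : ℕ) {q : ℂ} (hq : ‖q‖ < 1) :
    HasEval (PowerSeries.mk (fun n => (boundedCount k N n : ℂ))) q
      (∏ a ∈ Finset.range (N + 1), if k ∣ a then 1 else (1 - q ^ a)⁻¹) := by
  rw [mk_boundedCount, Finset.prod_range_succ', if_pos (dvd_zero k), mul_one]
  refine HasEval.prod _ fun i _ => ?_
  by_cases h : k ∣ i + 1
  · rw [if_neg (not_not.2 h), if_pos h]; exact HasEval.one q
  · rw [if_pos h, if_neg h]; exact hasEval_tsum_X_pow (Nat.succ_ne_zero i) hq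

end PowerSeriesEval

/-- Expand -log(1 - q^a) in powers of q^a and interchange with the finite sum over a. Bounding the
parts by N keeps this interchange finite. -/
theorem prod_eq_exp_tsum (k N : ℕ) {z : ℂ} (hz : 0 < z.re) :
    (∏ a ∈ Finset.range (N + 1), if k ∣ a then 1 else (1 - Complex.exp (-z) ^ a)⁻¹) =
      Complex.exp (∑' r : ℕ, (∑ a ∈ Finset.range (N + 1),
        if k ∣ a then 0 else Complex.exp (-(((r : ℂ) + 1) * z)) ^ a) / ((r : ℂ) + 1)) := by
  have key : ∀ a ∈ Finset.range (N + 1), HasSum (fun r : ℕ =>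
      (if k ∣ a then 0 else Complex.exp (-(((r : ℂ) + 1) * z)) ^ a) / ((r : ℂ) + 1))
      (if k ∣ a then 0 else -Complex.log (1 - Complex.exp (-z) ^ a)) := by
    intro a _
    split_ifs with h
    · simp
    · have ha : a ≠ 0 := by rintro rfl; exact h (dvd_zero k)
      have hq : ‖Complex.exp (-z) ^ a‖ < 1 := by
        rw [norm_pow, norm_exp_neg]; exact exp_neg_pow_lt_one hz ha
      have e : ∀ r : ℕ, Complex.exp (-(((r : ℂ) + 1) * z)) ^ a =
          (Complex.exp (-z) ^ a) ^ (r + 1) := by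
        intro r
        rw [← pow_mul, mul_comm a, pow_mul, ← Complex.exp_nat_mul (-z)]
        congr 2
        push_cast
        ring
      simp only [e]
      exact Complex.hasSum_taylorSeries_neg_log' hq
  have hsum := hasSum_sum key
  simp only [← Finset.sum_div] at hsum
  rw [hsum.tsum_eq, Complex.exp_sum]
  refine Finset.prod_congr rfl fun a _ => ?_
  split_ifs with h
  · simp
  · have ha : a ≠ 0 := by rintro rfl; exact h (dvd_zero k)
    rw [Complex.exp_neg (Complex.log _), Complex.exp_log (one_sub_exp_neg_pow_ne_zero hz ha)]

theorem tendsto_prod_logGen {k : ℕ} (hk : k ≠ 0) {z : ℂ} (hz : 0 < z.re) :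
    Tendsto (fun N : ℕ => ∏ a ∈ Finset.range (N + 1),
      if k ∣ a then 1 else (1 - Complex.exp (-z) ^ a)⁻¹) atTop (𝓝 (Complex.exp (logGen k z))) := by
  simp only [prod_eq_exp_tsum k _ hz]
  refine (Complex.continuous_exp.tendsto _).comp ?_
  refine tendsto_tsum_of_dominated_convergence (summable_inv_natCast_succ_sq_mul z.re) ?_ ?_
  · intro r
    refine Tendsto.div_const ?_ _
    have hw : 0 < (((r : ℂ) + 1) * z).re := by rw [natCast_succ_mul_re]; positivity
    exact (hasSum_kernel hk hw).tendsto_sum_nat.comp (tendsto_add_atTop_nat 1)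
  · refine Eventually.of_forall fun N r => le_trans ?_ (realKernel_div_le hk hz r)
    have hw : 0 < ((r : ℝ) + 1) * z.re := by positivity
    rw [norm_div, norm_natCast_succ]
    gcongr
    refine (norm_sum_le _ _).trans ?_
    refine le_trans (Finset.sum_le_sum fun a _ => ?_)
      (sum_le_hasSum (Finset.range (N + 1)) (fun a _ => ?_) (hasSum_realKernel hk hw))
    · split_ifs
      · simp
      · rw [norm_pow, norm_exp_neg, natCast_succ_mul_re]
    · split_ifs <;> positivity

/-- Counts with parts at most M agree with p_k(n) for n ≤ M, so each partial sum is at most a finite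
product. These products converge, hence are bounded. -/
theorem summable_regularCount {k : ℕ} (hk : k ≠ 0) {x : ℝ} (hx : 0 < x) :
    Summable fun n => (regularCount k n : ℝ) * Real.exp (-x) ^ n := by
  have hx' : 0 < (x : ℂ).re := by simpa using hx
  have hq : ‖Complex.exp (-(x : ℂ))‖ < 1 := by
    rw [norm_exp_neg]; simpa using hx
  obtain ⟨B, hB⟩ := (tendsto_prod_logGen hk hx').norm.bddAbove_range
  refine summable_of_sum_range_le (c := B) (fun _ => by positivity) fun M => ?_
  have h := hasEval_boundedCount k M hq
  have h2 := Complex.hasSum_re h.2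
  have h3 := sum_le_hasSum (Finset.range M) (fun n _ => ?_) h2
  · have e : ∀ n, (PowerSeries.coeff n (PowerSeries.mk fun n => (boundedCount k M n : ℂ)) *
        Complex.exp (-(x : ℂ)) ^ n).re = (boundedCount k M n : ℝ) * Real.exp (-x) ^ n := by
      intro n
      rw [PowerSeries.coeff_mk]
      norm_cast
    calc _ = ∑ n ∈ Finset.range M, (boundedCount k M n : ℝ) * Real.exp (-x) ^ n := by
          refine Finset.sum_congr rfl fun n hn => ?_
          rw [boundedCount_eq k (Finset.mem_range.1 hn).le]
      _ ≤ _ := by simpa only [e] using h3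
      _ ≤ _ := Complex.re_le_norm _
      _ ≤ B := hB ⟨M, rfl⟩
  · rw [PowerSeries.coeff_mk]
    norm_cast
    positivity

/-- Let the bound N on the parts tend to infinity: the series converges by domination and the
products converge to exp(L(z)), so the limits agree. -/
theorem hasSum_regularCount {k : ℕ} (hk : k ≠ 0) {z : ℂ} (hz : 0 < z.re) :
    HasSum (fun n => (regularCount k n : ℂ) * Complex.exp (-z) ^ n)
      (Complex.exp (logGen k z)) := by
  have hq : ‖Complex.exp (-z)‖ < 1 := by
    rw [norm_exp_neg]; simpa using hz
  have hbound := summable_regularCount hk hz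
  have hnorm : ∀ n, ‖(regularCount k n : ℂ) * Complex.exp (-z) ^ n‖ =
      (regularCount k n : ℝ) * Real.exp (-z.re) ^ n := by
    intro n
    rw [norm_mul, norm_pow, norm_exp_neg, Complex.norm_natCast]
  have hs : Summable fun n => (regularCount k n : ℂ) * Complex.exp (-z) ^ n :=
    Summable.of_norm_bounded hbound fun n => (hnorm n).le
  have h1 : Tendsto (fun N : ℕ => ∑' n, (boundedCount k N n : ℂ) * Complex.exp (-z) ^ n) atTop
      (𝓝 (∑' n, (regularCount k n : ℂ) * Complex.exp (-z) ^ n)) := by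
    refine tendsto_tsum_of_dominated_convergence hbound (fun n => ?_)
      (Eventually.of_forall fun N n => ?_)
    · refine tendsto_const_nhds.congr' ?_
      filter_upwards [eventually_ge_atTop n] with N hN
      rw [boundedCount_eq k hN]
    · rw [← hnorm, norm_mul, norm_mul, Complex.norm_natCast, Complex.norm_natCast]
      gcongr
      exact boundedCount_le k N n
  have h2 : ∀ N : ℕ, ∑' n, (boundedCount k N n : ℂ) * Complex.exp (-z) ^ n =
      ∏ a ∈ Finset.range (N + 1), if k ∣ a then 1 else (1 - Complex.exp (-z) ^ a)⁻¹ := by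
    intro N
    have h := (hasEval_boundedCount k N hq).2
    simp only [PowerSeries.coeff_mk] at h
    exact h.tsum_eq
  simp only [h2] at h1
  rw [← tendsto_nhds_unique h1 (tendsto_prod_logGen hk hz)]
  exact hs.hasSum

end RegularPartition

/-! ### Behaviour of the logarithm near its pole, and Cauchy's formula -/

namespace RegularPartition

open Filter Topology

/-- The function `1 / (e ^ w - 1) - 1 / w`, regular at the origin. -/
noncomputable def bernoulliFun (w : ℂ) : ℂ := 1 / (Complex.exp w - 1) - 1 / w

theorem le_norm_two_sinh_half {w : ℂ} (hw : 0 < w.re) :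
    w.re ≤ ‖Complex.exp (w / 2) - Complex.exp (-(w / 2))‖ := by
  have h1 := norm_sub_norm_le (Complex.exp (w / 2)) (Complex.exp (-(w / 2)))
  rw [Complex.norm_exp, Complex.norm_exp, Complex.neg_re] at h1
  have h2 : (w / 2).re = w.re / 2 := by simp
  rw [h2] at h1
  have h3 : w.re / 2 ≤ Real.sinh (w.re / 2) := Real.self_le_sinh_iff.2 (by linarith)
  rw [Real.sinh_eq] at h3
  linarith

theorem exp_sub_one_ne_zero {w : ℂ} (hw : 0 < w.re) : Complex.exp w - 1 ≠ 0 := by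
  intro h
  have h1 : ‖Complex.exp w‖ = 1 := by rw [sub_eq_zero.1 h, norm_one]
  rw [Complex.norm_exp, Real.exp_eq_one_iff] at h1
  linarith

theorem ne_zero_of_re_pos {w : ℂ} (hw : 0 < w.re) : w ≠ 0 := by
  rintro rfl
  simp at hw

theorem hasDerivAt_bernoulliFun {w : ℂ} (hw : 0 < w.re) : HasDerivAt bernoulliFun
    (1 / w ^ 2 - 1 / (Complex.exp (w / 2) - Complex.exp (-(w / 2))) ^ 2) w := by
  have h0 := ne_zero_of_re_pos hw
  have h1 := exp_sub_one_ne_zero hw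
  have hd1 := ((Complex.hasDerivAt_exp w).sub_const 1).fun_inv h1
  have hd2 := (hasDerivAt_id w).fun_inv h0
  have hd := hd1.sub hd2
  have e : (Complex.exp (w / 2) - Complex.exp (-(w / 2))) ^ 2 =
      (Complex.exp w - 1) ^ 2 / Complex.exp w := by
    have h2 : Complex.exp w = Complex.exp (w / 2) ^ 2 := by
      rw [← Complex.exp_nat_mul]; congr 1; push_cast; ring
    have h3 : Complex.exp (w / 2) ≠ 0 := Complex.exp_ne_zero _
    rw [h2, Complex.exp_neg]
    field_simp
  have hf : bernoulliFun = (fun w => (Complex.exp w - 1)⁻¹) - fun w => w⁻¹ := by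
    ext w
    simp [bernoulliFun]
  rw [hf]
  refine hd.congr_deriv ?_
  rw [e, one_div_div]
  simp only [id]
  ring

theorem norm_deriv_bernoulliFun_le {w : ℂ} (hw : 0 < w.re) :
    ‖1 / w ^ 2 - 1 / (Complex.exp (w / 2) - Complex.exp (-(w / 2))) ^ 2‖ ≤ 2 / w.re ^ 2 := by
  have h1 := le_norm_two_sinh_half hw
  have h2 : w.re ≤ ‖w‖ := Complex.re_le_norm w
  refine (norm_sub_le _ _).trans ?_
  rw [norm_div, norm_div, norm_pow, norm_pow, norm_one]
  have h3 : 1 / ‖w‖ ^ 2 ≤ 1 / w.re ^ 2 := by gcongr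
  have h4 : 1 / ‖Complex.exp (w / 2) - Complex.exp (-(w / 2))‖ ^ 2 ≤ 1 / w.re ^ 2 := by gcongr
  calc _ ≤ 1 / w.re ^ 2 + 1 / w.re ^ 2 := add_le_add h3 h4
    _ = _ := by ring

/-- The poles cancel: a = 2 sinh(w/2) is w + O(w³), and 1/w² - 1/a² = (a - w)(a + w)/(w²a²) has
numerator O(w⁴). -/
theorem norm_deriv_bernoulliFun_le_one {w : ℂ} (hw0 : w ≠ 0) (hw : ‖w‖ ≤ 1) :
    ‖1 / w ^ 2 - 1 / (Complex.exp (w / 2) - Complex.exp (-(w / 2))) ^ 2‖ ≤ 1 := by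
  have hw0' : 0 < ‖w‖ := norm_pos_iff.2 hw0
  have ht : ‖w / 2‖ = ‖w‖ / 2 := by simp
  have b1 := Complex.exp_bound (x := w / 2) (by rw [ht]; linarith) (n := 3) (by norm_num)
  have b2 := Complex.exp_bound (x := -(w / 2)) (by rw [norm_neg, ht]; linarith) (n := 3)
    (by norm_num)
  rw [norm_neg] at b2
  rw [ht] at b1 b2
  set a := Complex.exp (w / 2) - Complex.exp (-(w / 2)) with ha
  have h1 : ‖a - w‖ ≤ ‖w‖ ^ 3 / 18 := by
    have e : a - w = (Complex.exp (w / 2) - ∑ m ∈ Finset.range 3, (w / 2) ^ m / (m.factorial : ℂ)) -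
        (Complex.exp (-(w / 2)) -
          ∑ m ∈ Finset.range 3, (-(w / 2)) ^ m / (m.factorial : ℂ)) := by
      simp only [Finset.sum_range_succ, Finset.sum_range_zero, ha, Nat.factorial]
      push_cast
      ring
    rw [e]
    refine (norm_sub_le _ _).trans ((add_le_add b1 b2).trans (le_of_eq ?_))
    simp only [Nat.factorial]
    norm_num
    ring
  have h1' : ‖a - w‖ ≤ ‖w‖ / 18 := by
    refine h1.trans ?_
    have : ‖w‖ ^ 3 ≤ ‖w‖ := by
      calc ‖w‖ ^ 3 ≤ ‖w‖ ^ 1 := pow_le_pow_of_le_one hw0'.le hw (by norm_num)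
        _ = ‖w‖ := pow_one _
    linarith
  have h2 : ‖w‖ / 2 ≤ ‖a‖ := by
    have := norm_sub_norm_le w a
    rw [norm_sub_rev w a] at this
    linarith
  have h3 : ‖a + w‖ ≤ 3 * ‖w‖ := by
    have : a + w = (a - w) + 2 * w := by ring
    rw [this]
    refine (norm_add_le _ _).trans ?_
    rw [norm_mul, Complex.norm_ofNat]
    linarith
  have ha0 : a ≠ 0 := norm_pos_iff.1 (by linarith)
  have e : 1 / w ^ 2 - 1 / a ^ 2 = (a - w) * (a + w) / (w ^ 2 * a ^ 2) := by
    field_simp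
    ring
  rw [e, norm_div, norm_mul, norm_mul, norm_pow, norm_pow, div_le_one (by positivity)]
  calc ‖a - w‖ * ‖a + w‖ ≤ ‖w‖ ^ 3 / 18 * (3 * ‖w‖) := by gcongr
    _ = ‖w‖ ^ 2 * (‖w‖ ^ 2 / 6) := by ring
    _ ≤ ‖w‖ ^ 2 * (‖w‖ / 2) ^ 2 := by
        gcongr
        nlinarith
    _ ≤ _ := by gcongr

/-- The exponent 5/4 can be any number strictly between 1, needed to sum over the multiples (r+1)z
in L, and 3/2, needed for the error to vanish at the scale δ ~ x^{3/2}. Boundedness covers small w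
and the bound 2/(Re w)² covers large w. -/
theorem norm_deriv_bernoulliFun_le_rpow {w : ℂ} (hw : 0 < w.re) (hv : |w.im| ≤ w.re) :
    ‖1 / w ^ 2 - 1 / (Complex.exp (w / 2) - Complex.exp (-(w / 2))) ^ 2‖ ≤
      4 * w.re ^ (-(5 / 4) : ℝ) := by
  rcases le_total w.re (1 / 2) with h | h
  · have hn : ‖w‖ ≤ 1 := by
      refine (Complex.norm_le_abs_re_add_abs_im w).trans ?_
      rw [abs_of_pos hw]; linarith
    refine (norm_deriv_bernoulliFun_le_one (ne_zero_of_re_pos hw) hn).trans ?_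
    have : 1 ≤ w.re ^ (-(5 / 4) : ℝ) :=
      Real.one_le_rpow_of_pos_of_le_one_of_nonpos hw (by linarith) (by norm_num)
    linarith
  · refine (norm_deriv_bernoulliFun_le hw).trans ?_
    have e : 2 / w.re ^ 2 = 2 * w.re ^ (-(3 / 4) : ℝ) * w.re ^ (-(5 / 4) : ℝ) := by
      rw [mul_assoc, ← Real.rpow_add hw, div_eq_mul_inv, ← Real.rpow_natCast, ← Real.rpow_neg hw.le]
      norm_num
    rw [e]
    have h2 : w.re ^ (-(3 / 4) : ℝ) ≤ 2 := by
      calc w.re ^ (-(3 / 4) : ℝ) ≤ (1 / 2 : ℝ) ^ (-(3 / 4) : ℝ) :=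
            Real.rpow_le_rpow_of_nonpos (by norm_num) h (by norm_num)
        _ ≤ (1 / 2 : ℝ) ^ (-1 : ℝ) :=
            Real.rpow_le_rpow_of_exponent_ge (by norm_num) (by norm_num) (by norm_num)
        _ = 2 := by rw [Real.rpow_neg_one]; norm_num
    have h3 : 0 ≤ w.re ^ (-(5 / 4) : ℝ) := by positivity
    nlinarith

theorem norm_bernoulliFun_sub_le {u v : ℝ} (hu : 0 < u) (hv : |v| ≤ u) :
    ‖bernoulliFun (u + v * Complex.I) - bernoulliFun u‖ ≤ 4 * u ^ (-(5 / 4) : ℝ) * |v| := by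
  have hre : ∀ t : ℝ, ((u : ℂ) + t * Complex.I).re = u := fun t => by simp
  have him : ∀ t : ℝ, ((u : ℂ) + t * Complex.I).im = t := fun t => by simp
  have hd : ∀ t ∈ Set.Icc (-u) u, HasDerivWithinAt
      (fun t : ℝ => bernoulliFun (u + t * Complex.I))
      ((1 / ((u : ℂ) + t * Complex.I) ^ 2 - 1 / (Complex.exp (((u : ℂ) + t * Complex.I) / 2) -
        Complex.exp (-(((u : ℂ) + t * Complex.I) / 2))) ^ 2) * Complex.I) (Set.Icc (-u) u) t := by
    intro t _
    have h1 : HasDerivAt (fun t : ℝ => (u : ℂ) + t * Complex.I) Complex.I t := by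
      have := ((Complex.ofRealCLM.hasDerivAt (x := t)).mul_const Complex.I).const_add (u : ℂ)
      simpa using this
    exact ((hasDerivAt_bernoulliFun (by rw [hre]; exact hu)).comp t h1).hasDerivWithinAt
  have h := Convex.norm_image_sub_le_of_norm_hasDerivWithin_le (x := 0) (y := v) hd
    (C := 4 * u ^ (-(5 / 4) : ℝ)) (fun t ht => ?_) (convex_Icc _ _)
    ⟨by linarith, hu.le⟩ (abs_le.1 hv)
  · simpa using h
  · rw [norm_mul, Complex.norm_I, mul_one]
    have := norm_deriv_bernoulliFun_le_rpow (w := (u : ℂ) + t * Complex.I) (by rw [hre]; exact hu)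
      (by rw [hre, him]; exact abs_le.2 ht)
    rwa [hre] at this

theorem kernel_eq_bernoulliFun {k : ℕ} (hk : k ≠ 0) {w : ℂ} (hw : 0 < w.re) :
    kernel k w = (1 - 1 / k) / w + (bernoulliFun w - bernoulliFun (k * w)) := by
  have h0 := ne_zero_of_re_pos hw
  have hk' : (k : ℂ) ≠ 0 := Nat.cast_ne_zero.2 hk
  rw [kernel_eq hk hw, bernoulliFun, bernoulliFun]
  have : (1 - 1 / (k : ℂ)) / w = 1 / w - 1 / (k * w) := by field_simp
  rw [this]
  ring

theorem norm_kernel_sub_le {k : ℕ} (hk : k ≠ 0) {u v : ℝ} (hu : 0 < u) (hv : |v| ≤ u) :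
    ‖(kernel k (u + v * Complex.I) - (1 - 1 / k) / (u + v * Complex.I)) -
      (kernel k u - (1 - 1 / k) / u)‖ ≤ 4 * (1 + k) * u ^ (-(5 / 4) : ℝ) * |v| := by
  have hk1 : (1 : ℝ) ≤ k := by exact_mod_cast Nat.one_le_iff_ne_zero.2 hk
  rw [kernel_eq_bernoulliFun hk (by simpa using hu), kernel_eq_bernoulliFun hk (w := (u : ℂ))
    (by simpa using hu)]
  have h1 := norm_bernoulliFun_sub_le hu hv
  have h2 := norm_bernoulliFun_sub_le (u := k * u) (v := k * v) (by positivity) (by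
    rw [abs_mul, Nat.abs_cast]; gcongr)
  have h3 : (k * u : ℝ) ^ (-(5 / 4) : ℝ) ≤ u ^ (-(5 / 4) : ℝ) :=
    Real.rpow_le_rpow_of_nonpos hu (le_mul_of_one_le_left hu.le hk1) (by norm_num)
  have e : ((1 - 1 / (k : ℂ)) / (u + v * Complex.I) + (bernoulliFun (u + v * Complex.I) -
      bernoulliFun (k * (u + v * Complex.I))) - (1 - 1 / k) / (u + v * Complex.I)) -
      ((1 - 1 / k) / u + (bernoulliFun u - bernoulliFun (k * u)) - (1 - 1 / k) / u) =
      (bernoulliFun (u + v * Complex.I) - bernoulliFun u) -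
      (bernoulliFun (((k * u : ℝ) : ℂ) + ((k * v : ℝ) : ℂ) * Complex.I) -
        bernoulliFun ((k * u : ℝ) : ℂ)) := by
    push_cast
    rw [mul_add, mul_assoc (k : ℂ) (v : ℂ)]
    ring
  rw [e]
  refine (norm_sub_le _ _).trans ((add_le_add h1 h2).trans ?_)
  rw [abs_mul, Nat.abs_cast]
  calc _ ≤ 4 * u ^ (-(5 / 4) : ℝ) * |v| + 4 * u ^ (-(5 / 4) : ℝ) * (k * |v|) := by gcongr
    _ = _ := by ring

theorem hasSum_inv_natCast_succ_sq_mul (c : ℂ) (z : ℂ) :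
    HasSum (fun r : ℕ => c / (((r : ℂ) + 1) * z) / ((r : ℂ) + 1)) (c * (Real.pi ^ 2 / 6 : ℝ) / z) := by
  have h : HasSum (fun r : ℕ => (((r : ℝ) + 1) ^ 2)⁻¹) (Real.pi ^ 2 / 6) := by
    simpa using (hasSum_nat_add_iff' 1).2 hasSum_zeta_two
  have h2 := (Complex.hasSum_ofReal.2 h).mul_left (c / z)
  have e : (fun r : ℕ => c / (((r : ℂ) + 1) * z) / ((r : ℂ) + 1)) =
      fun r : ℕ => c / z * (((r : ℂ) + 1) ^ 2)⁻¹ := by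
    ext r
    rw [div_div, mul_right_comm, ← sq, mul_comm _ z, ← div_div, div_eq_mul_inv _ (_ ^ 2)]
  rw [e, mul_div_right_comm]
  push_cast at h2 ⊢
  exact h2

theorem summable_natCast_succ_rpow : Summable fun r : ℕ => ((r : ℝ) + 1) ^ (-(5 / 4) : ℝ) := by
  have h := (summable_nat_add_iff 1).2 (Real.summable_nat_rpow.2 (by norm_num : (-(5 / 4) : ℝ) < -1))
  simpa using h

/-- Summing the poles of the terms gives ζ(2)(1 - 1/k)/z. Only the variation of the remainder along
a vertical segment is estimated, so constant or logarithmic terms of L at 0 need not be identified.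
-/
theorem norm_logGen_sub_le {k : ℕ} (hk : k ≠ 0) {x θ : ℝ} (hx : 0 < x) (hθ : |θ| ≤ x) :
    ‖(logGen k (x + θ * Complex.I) - (1 - 1 / k) * (Real.pi ^ 2 / 6 : ℝ) / (x + θ * Complex.I)) -
      (logGen k x - (1 - 1 / k) * (Real.pi ^ 2 / 6 : ℝ) / x)‖ ≤
      (4 * (1 + k) * ∑' r : ℕ, ((r : ℝ) + 1) ^ (-(5 / 4) : ℝ)) * x ^ (-(5 / 4) : ℝ) * |θ| := by
  have h1 := ((summable_logGen hk (z := (x : ℂ) + θ * Complex.I) (by simpa using hx)).hasSum.sub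
    (hasSum_inv_natCast_succ_sq_mul (1 - 1 / k) (x + θ * Complex.I))).sub
    ((summable_logGen hk (z := (x : ℂ)) (by simpa using hx)).hasSum.sub
    (hasSum_inv_natCast_succ_sq_mul (1 - 1 / k) x))
  have h2 : HasSum (fun r : ℕ => 4 * (1 + k) * x ^ (-(5 / 4) : ℝ) * |θ| *
      ((r : ℝ) + 1) ^ (-(5 / 4) : ℝ)) _ := summable_natCast_succ_rpow.hasSum.mul_left _
  refine (h1.norm_le_of_bounded h2 fun r => ?_).trans (le_of_eq (by ring))
  have hr : (0 : ℝ) < (r : ℝ) + 1 := by positivity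
  have h3 := norm_kernel_sub_le hk (u := ((r : ℝ) + 1) * x) (v := ((r : ℝ) + 1) * θ)
    (by positivity) (by rw [abs_mul, abs_of_pos hr]; gcongr)
  rw [← sub_div, ← sub_div, ← sub_div, norm_div, norm_natCast_succ, div_le_iff₀ hr]
  have e : ((((r : ℝ) + 1) * x : ℝ) : ℂ) + ((((r : ℝ) + 1) * θ : ℝ) : ℂ) * Complex.I =
      ((r : ℂ) + 1) * (x + θ * Complex.I) := by push_cast; ring
  have e' : ((((r : ℝ) + 1) * x : ℝ) : ℂ) = ((r : ℂ) + 1) * x := by push_cast; ring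
  rw [e, e', abs_mul, abs_of_pos hr, Real.mul_rpow hr.le hx.le] at h3
  exact h3.trans (le_of_eq (by ring))

theorem integral_exp_int_mul_I (l : ℤ) :
    ∫ θ in (-Real.pi)..Real.pi, Complex.exp (l * Complex.I * θ) =
      if l = 0 then ((2 * Real.pi : ℝ) : ℂ) else 0 := by
  split_ifs with h
  · subst h
    simp
    ring
  · have hl : (l : ℂ) * Complex.I ≠ 0 := mul_ne_zero (Int.cast_ne_zero.2 h) Complex.I_ne_zero
    rw [integral_exp_mul_complex hl]
    have : Complex.exp (l * Complex.I * Real.pi) =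
        -- The two exponents differ by l · 2πi.
        Complex.exp (l * Complex.I * ((-Real.pi : ℝ) : ℂ)) := by
      rw [Complex.exp_eq_exp_iff_exists_int]
      exact ⟨l, by push_cast; ring⟩
    rw [this, sub_self, zero_div]

theorem integral_exp_logGen {k : ℕ} (hk : k ≠ 0) {x : ℝ} (hx : 0 < x) (n : ℕ) :
    ∫ θ in (-Real.pi)..Real.pi, Complex.exp (logGen k (x + θ * Complex.I)) *
      Complex.exp (n * (x + θ * Complex.I)) = ((2 * Real.pi : ℝ) : ℂ) * regularCount k n := by
  have hre : ∀ θ : ℝ, ((x : ℂ) + θ * Complex.I).re = x := fun θ => by simp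
  have hsum := intervalIntegral.hasSum_integral_of_dominated_convergence
    (μ := MeasureTheory.volume) (a := -Real.pi) (b := Real.pi)
    (F := fun (m : ℕ) (θ : ℝ) => (regularCount k m : ℂ) *
      Complex.exp (-((x : ℂ) + θ * Complex.I)) ^ m * Complex.exp (n * (x + θ * Complex.I)))
    (f := fun θ : ℝ => Complex.exp (logGen k (x + θ * Complex.I)) *
      Complex.exp (n * (x + θ * Complex.I)))
    (fun m _ => (regularCount k m : ℝ) * Real.exp (-x) ^ m * Real.exp (n * x))
    (fun m => by fun_prop)
    (fun m => Eventually.of_forall fun θ _ => ?_)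
    (Eventually.of_forall fun θ _ => (summable_regularCount hk hx).mul_right _)
    (by simp)
    (Eventually.of_forall fun θ _ =>
      (hasSum_regularCount hk (by rw [hre]; exact hx)).mul_right _)
  · refine hsum.unique ?_
    have hterm : ∀ m : ℕ, (∫ θ in (-Real.pi)..Real.pi, (regularCount k m : ℂ) *
        Complex.exp (-((x : ℂ) + θ * Complex.I)) ^ m * Complex.exp (n * (x + θ * Complex.I))) =
        if m = n then ((2 * Real.pi : ℝ) : ℂ) * regularCount k n else 0 := by
      intro m
      have e : ∀ θ : ℝ, (regularCount k m : ℂ) *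
          Complex.exp (-((x : ℂ) + θ * Complex.I)) ^ m * Complex.exp (n * (x + θ * Complex.I)) =
          (regularCount k m : ℂ) * Complex.exp (((n : ℂ) - m) * x) *
            Complex.exp ((((n : ℤ) - m : ℤ) : ℂ) * Complex.I * θ) := by
        intro θ
        rw [← Complex.exp_nat_mul, mul_assoc, mul_assoc, ← Complex.exp_add, ← Complex.exp_add]
        congr 2
        push_cast
        ring
      simp only [e]
      rw [intervalIntegral.integral_const_mul, integral_exp_int_mul_I]
      by_cases hmn : m = n
      · subst hmn
        simp [mul_comm]
      · rw [if_neg (by omega), if_neg hmn, mul_zero]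
    simp only [hterm]
    exact hasSum_ite_eq n _
  · rw [norm_mul, norm_mul, norm_pow, norm_exp_neg, hre, Complex.norm_natCast, Complex.norm_exp]
    simp

end RegularPartition

/-! ### Saddle point analysis: pointwise limit and domination -/

namespace RegularPartition

open Filter Topology MeasureTheory

/-- The leading coefficient of `logGen k` at the origin. -/
noncomputable def poleCoeff (k : ℕ) : ℝ := (1 - 1 / k) * (Real.pi ^ 2 / 6)

theorem poleCoeff_pos {k : ℕ} (hk : 2 ≤ k) : 0 < poleCoeff k := by
  have hk2 : (2 : ℝ) ≤ k := by exact_mod_cast hk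
  have : 1 / (k : ℝ) ≤ 1 / 2 := one_div_le_one_div_of_le (by norm_num) hk2
  have := Real.pi_pos
  unfold poleCoeff
  have : 0 < 1 - 1 / (k : ℝ) := by linarith
  positivity

theorem poleCoeff_eq {k : ℕ} (hk : 2 ≤ k) : poleCoeff k = (2 * Real.pi * √(m k)) ^ 2 := by
  rw [mul_pow, Real.sq_sqrt (m_pos hk).le, poleCoeff, m]
  have : (k : ℝ) ≠ 0 := by positivity
  field_simp
  ring

/-- Saddle point abscissas `x` and scales `δ` along which the generating function of `k`-regular
partitions has a Gaussian profile. -/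
structure IsSaddle (k : ℕ) (x δ : ℕ → ℝ) : Prop where
  x_pos : ∀ᶠ n in atTop, 0 < x n
  x_lim : Tendsto x atTop (𝓝 0)
  δ_pos : ∀ᶠ n in atTop, 0 < δ n
  ratio : Tendsto (fun n => δ n ^ 2 / x n ^ 3) atTop (𝓝 (1 / (4 * poleCoeff k)))
  stationary : Tendsto (fun n : ℕ => δ n * (n - poleCoeff k / x n ^ 2)) atTop (𝓝 0)

/-- The integrand of the coefficient integral, normalized at its saddle point. -/
noncomputable def weight (k n : ℕ) (x δ s : ℝ) : ℂ :=
  Complex.exp (logGen k (x + (δ * s : ℝ) * Complex.I) - logGen k x + n * (δ * s : ℝ) * Complex.I)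

variable {k : ℕ} {x δ : ℕ → ℝ}

/-- The ratio condition makes δ comparable to x^{3/2}. It is used with p = 0, 1 and 5/4. -/
theorem IsSaddle.tendsto_sqrt_ratio (h : IsSaddle k x δ) {p : ℝ} (hp : p < 3 / 2) :
    Tendsto (fun n => δ n * x n ^ (-p)) atTop (𝓝 0) := by
  have h1 : Tendsto (fun n => x n ^ (3 / 2 - p)) atTop (𝓝 0) := by
    have := h.x_lim.rpow_const (p := 3 / 2 - p) (Or.inr (by linarith))
    rwa [Real.zero_rpow (by linarith)] at this
  have h2 := h.ratio.sqrt.mul h1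
  rw [mul_zero] at h2
  refine h2.congr' ?_
  filter_upwards [h.x_pos, h.δ_pos] with n hx hδ
  have e : √(δ n ^ 2 / x n ^ 3) = δ n * x n ^ (-(3 / 2) : ℝ) := by
    rw [Real.sqrt_eq_iff_mul_self_eq (by positivity) (by positivity)]
    rw [mul_mul_mul_comm, ← Real.rpow_add hx, div_eq_mul_inv, ← Real.rpow_natCast (x n),
      ← Real.rpow_neg hx.le, sq]
    norm_num
  rw [e, mul_assoc, ← Real.rpow_add hx]
  congr 2
  ring

theorem IsSaddle.tendsto_div (h : IsSaddle k x δ) :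
    Tendsto (fun n => δ n / x n) atTop (𝓝 0) := by
  refine (h.tendsto_sqrt_ratio (p := 1) (by norm_num)).congr fun n => ?_
  rw [Real.rpow_neg_one, div_eq_mul_inv]

theorem IsSaddle.tendsto_δ (h : IsSaddle k x δ) : Tendsto δ atTop (𝓝 0) := by
  simpa using h.tendsto_sqrt_ratio (p := 0) (by norm_num)

/-- With C = `poleCoeff k` and θ = δs, C/(x + iθ) - C/x = -iCθ/x² - (Cθ²/x³)/(1 + iθ/x). The linear
part combines with inθ and vanishes by stationarity, the quadratic part tends to -s²/4 by the ratio
condition, and the remainder `E` is O(δ x^{-5/4}|s|). -/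
theorem IsSaddle.tendsto_weight (hk : 2 ≤ k) (h : IsSaddle k x δ) (s : ℝ) :
    Tendsto (fun n => weight k n (x n) (δ n) s) atTop (𝓝 (Real.exp (-s ^ 2 / 4) : ℂ)) := by
  have hC := poleCoeff_pos hk
  unfold weight
  rw [Complex.ofReal_exp]
  refine (Complex.continuous_exp.tendsto _).comp ?_
  set E : ℕ → ℂ := fun n =>
    (logGen k (x n + (δ n * s : ℝ) * Complex.I) -
      poleCoeff k / (x n + (δ n * s : ℝ) * Complex.I)) -
      (logGen k (x n) - poleCoeff k / x n) with hE
  have hsmall : ∀ᶠ n in atTop, |δ n * s| ≤ x n := by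
    have h1 := (h.tendsto_div.mul_const s).abs
    rw [zero_mul, abs_zero] at h1
    filter_upwards [h1.eventually_lt_const one_pos, h.x_pos] with n hn hx
    have e : δ n / x n * s = δ n * s / x n := by ring
    rw [e, abs_div, abs_of_pos hx, div_lt_one hx] at hn
    exact hn.le
  have hE0 : Tendsto E atTop (𝓝 0) := by
    set K := 4 * (1 + k) * ∑' r : ℕ, ((r : ℝ) + 1) ^ (-(5 / 4) : ℝ) with hK
    have h1 := ((h.tendsto_sqrt_ratio (p := 5 / 4) (by norm_num)).mul_const s).abs.const_mul K
    rw [zero_mul, abs_zero, mul_zero] at h1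
    refine squeeze_zero_norm' ?_ h1
    filter_upwards [hsmall, h.x_pos] with n hn hx
    have h2 := norm_logGen_sub_le (by omega : k ≠ 0) hx hn
    have e : ((1 - 1 / k : ℂ)) * (Real.pi ^ 2 / 6 : ℝ) = poleCoeff k := by
      unfold poleCoeff; push_cast; rfl
    rw [e] at h2
    refine h2.trans (le_of_eq ?_)
    rw [abs_mul, abs_mul, abs_mul, abs_of_pos (Real.rpow_pos_of_pos hx _)]
    ring
  have hlin : Tendsto (fun n : ℕ => (s * (δ n * (n - poleCoeff k / x n ^ 2)) : ℝ) * Complex.I)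
      atTop (𝓝 0) := by
    have h1 := (h.stationary.const_mul s).ofReal.mul_const Complex.I
    simpa using h1
  have hquad : Tendsto (fun n : ℕ => ((poleCoeff k * s ^ 2 * (δ n ^ 2 / x n ^ 3) : ℝ) : ℂ) /
      (1 + (δ n / x n * s : ℝ) * Complex.I)) atTop (𝓝 ((s ^ 2 / 4 : ℝ) : ℂ)) := by
    have h1 := (h.ratio.const_mul (poleCoeff k * s ^ 2)).ofReal
    have h2 := ((h.tendsto_div.mul_const s).ofReal.mul_const Complex.I).const_add 1
    have h3 := h1.div h2 (by simp)
    rw [show poleCoeff k * s ^ 2 * (1 / (4 * poleCoeff k)) = s ^ 2 / 4 by field_simp] at h3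
    simpa [Pi.div_def] using h3
  have hall := (hE0.add hlin).sub hquad
  have e : (0 : ℂ) + 0 - ((s ^ 2 / 4 : ℝ) : ℂ) = ((-s ^ 2 / 4 : ℝ) : ℂ) := by
    push_cast; ring
  rw [e] at hall
  refine hall.congr' ?_
  filter_upwards [h.x_pos] with n hx
  have hx' : (x n : ℂ) ≠ 0 := Complex.ofReal_ne_zero.2 hx.ne'
  have hz : (x n : ℂ) + (δ n * s : ℝ) * Complex.I ≠ 0 := ne_zero_of_re_pos (by simpa using hx)
  have hz1 : (1 : ℂ) + (δ n / x n * s : ℝ) * Complex.I ≠ 0 := ne_zero_of_re_pos (by simp)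
  have e1 : (x n : ℂ) + (δ n * s : ℝ) * Complex.I =
      x n * (1 + (δ n / x n * s : ℝ) * Complex.I) := by
    push_cast
    field_simp
  have e2 : (poleCoeff k : ℂ) / (x n + (δ n * s : ℝ) * Complex.I) - poleCoeff k / x n =
      -(poleCoeff k * s * δ n / x n ^ 2) * Complex.I -
      ((poleCoeff k * s ^ 2 * (δ n ^ 2 / x n ^ 3) : ℝ) : ℂ) /
      (1 + (δ n / x n * s : ℝ) * Complex.I) := by
    rw [e1]
    have key : ∀ w : ℂ, 1 + w ≠ 0 → (poleCoeff k : ℂ) / (x n * (1 + w)) - poleCoeff k / x n =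
        -(poleCoeff k * w / x n) + poleCoeff k * w ^ 2 / x n / (1 + w) := by
      intro w hw
      field_simp
      ring
    rw [key _ hz1, mul_pow, Complex.I_sq]
    have e3 : (poleCoeff k : ℂ) * ((δ n / x n * s : ℝ) ^ 2 * -1) / x n =
        -((poleCoeff k * s ^ 2 * (δ n ^ 2 / x n ^ 3) : ℝ) : ℂ) := by
      push_cast
      field_simp
    rw [e3]
    push_cast
    field_simp
    ring
  simp only [hE]
  have e3 : ((s * (δ n * (n - poleCoeff k / x n ^ 2)) : ℝ) : ℂ) * Complex.I =
      n * (δ n * s : ℝ) * Complex.I - (poleCoeff k * s * δ n / x n ^ 2) * Complex.I := by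
    push_cast; ring
  rw [e3]
  linear_combination -e2

theorem norm_weight_le (hk : 2 ≤ k) : ∃ c : ℝ, 0 < c ∧ ∀ (n : ℕ) (x δ s : ℝ), 0 < x → x ≤ 1 →
    |δ * s| ≤ Real.pi → ‖weight k n x δ s‖ ≤ Real.exp (-(c / x * min 1 ((δ * s / x) ^ 2))) := by
  obtain ⟨c, hc, hgap⟩ := exists_kernel_gap hk
  refine ⟨c, hc, fun n x δ s hx hx1 hs => ?_⟩
  rw [weight, Complex.norm_exp, Real.exp_le_exp]
  have h1 := (hgap x (δ * s) hx hx1 hs).trans (logGen_gap (by omega) hx (δ * s))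
  have h2 : ((n : ℂ) * (δ * s : ℝ) * Complex.I).re = 0 := by simp
  rw [Complex.add_re, Complex.sub_re, h2]
  linarith

/-- For |δs| ≤ x the exponent is at least a multiple of s². Beyond that it is only c/x, while s² can
be as large as π²/δ², of order x^{-3}; this is why a cube is needed. -/
theorem IsSaddle.eventually_one_add_sq_le (hk : 2 ≤ k) (h : IsSaddle k x δ) {c : ℝ} (hc : 0 < c) :
    ∃ c' : ℝ, 0 < c' ∧ ∀ᶠ n in atTop, ∀ s, |δ n * s| ≤ Real.pi →
      c' * (1 + s ^ 2) ≤ (1 + c / x n * min 1 ((δ n * s / x n) ^ 2)) ^ 3 := by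
  have hC := poleCoeff_pos hk
  obtain ⟨β, hβ, hβ'⟩ := exists_between (show 0 < 1 / (4 * poleCoeff k) by positivity)
  have hpi := Real.pi_pos
  refine ⟨min (c ^ 3 / (1 + Real.pi ^ 2 / β)) (min 1 (c * β)), by positivity, ?_⟩
  filter_upwards [h.ratio.eventually_const_lt hβ', h.x_pos, h.δ_pos,
    h.x_lim.eventually_lt_const one_pos] with n hr hx hδ hx1 s hs
  rw [lt_div_iff₀ (by positivity)] at hr
  rcases le_total 1 ((δ n * s / x n) ^ 2) with hm | hm
  · rw [min_eq_left hm, mul_one]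
    have h1 : s ^ 2 ≤ Real.pi ^ 2 / (β * x n ^ 3) := by
      rw [le_div_iff₀ (by positivity)]
      calc s ^ 2 * (β * x n ^ 3) ≤ s ^ 2 * δ n ^ 2 := by gcongr
        _ = |δ n * s| ^ 2 := by rw [sq_abs]; ring
        _ ≤ _ := by gcongr
    have h2 : 1 + s ^ 2 ≤ (1 + Real.pi ^ 2 / β) / x n ^ 3 := by
      have h3 : 1 ≤ 1 / x n ^ 3 := by
        rw [le_div_iff₀ (by positivity), one_mul]
        exact pow_le_one₀ hx.le hx1.le
      have e : (1 + Real.pi ^ 2 / β) / x n ^ 3 = 1 / x n ^ 3 + Real.pi ^ 2 / (β * x n ^ 3) := by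
        rw [add_div, div_div]
      rw [e]
      linarith
    calc _ ≤ c ^ 3 / (1 + Real.pi ^ 2 / β) * ((1 + Real.pi ^ 2 / β) / x n ^ 3) := by
          gcongr
          exact min_le_left _ _
      _ = (c / x n) ^ 3 := by field_simp
      _ ≤ _ := by gcongr; linarith
  · rw [min_eq_right hm]
    have h1 : c * β * s ^ 2 ≤ c / x n * (δ n * s / x n) ^ 2 := by
      have e : c / x n * (δ n * s / x n) ^ 2 = c * s ^ 2 * δ n ^ 2 / x n ^ 3 := by field_simp
      rw [e, le_div_iff₀ (by positivity)]
      calc _ = c * s ^ 2 * (β * x n ^ 3) := by ring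
        _ ≤ _ := by gcongr
    have hL : 0 ≤ c / x n * (δ n * s / x n) ^ 2 := by positivity
    have hmin : min (c ^ 3 / (1 + Real.pi ^ 2 / β)) (min 1 (c * β)) ≤ min 1 (c * β) :=
      min_le_right _ _
    have hm1 : min 1 (c * β) ≤ 1 := min_le_left _ _
    have hm2 : min 1 (c * β) ≤ c * β := min_le_right _ _
    calc _ ≤ min 1 (c * β) * (1 + s ^ 2) := by gcongr
      _ = min 1 (c * β) + min 1 (c * β) * s ^ 2 := by ring
      _ ≤ 1 + c * β * s ^ 2 := by gcongr
      _ ≤ 1 + c / x n * (δ n * s / x n) ^ 2 := by gcongr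
      _ ≤ _ := le_self_pow₀ (by linarith) (by norm_num)

theorem IsSaddle.eventually_norm_weight_le (hk : 2 ≤ k) (h : IsSaddle k x δ) (D : ℕ) :
    ∃ M : ℝ, 0 < M ∧ ∀ᶠ n in atTop, ∀ s, |δ n * s| ≤ Real.pi →
      ‖weight k n (x n) (δ n) s‖ ≤ M / (1 + s ^ 2) ^ D := by
  obtain ⟨c, hc, hw⟩ := norm_weight_le hk
  obtain ⟨c', hc', hs⟩ := h.eventually_one_add_sq_le hk hc
  -- From e^{-L}(1 + L)^{3D} ≤ (3D)! e and (1 + L)³ ≥ c'(1 + s²).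
  refine ⟨(3 * D).factorial * Real.exp 1 / c' ^ D, by positivity, ?_⟩
  filter_upwards [hs, h.x_pos, h.x_lim.eventually_lt_const one_pos] with n hn hx hx1 s hsπ
  refine (hw n _ _ s hx hx1.le hsπ).trans ?_
  set L := c / x n * min 1 ((δ n * s / x n) ^ 2) with hL
  have hL0 : 0 ≤ L := by positivity
  rw [le_div_iff₀ (by positivity), le_div_iff₀ (by positivity)]
  refine le_trans ?_ (exp_neg_mul_one_add_pow_le (3 * D) hL0)
  rw [mul_assoc, ← mul_pow, pow_mul]
  gcongr
  rw [mul_comm]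
  exact hn s hsπ

/-- The deformation of `X - i s` entering the renormalized Jensen polynomial. -/
noncomputable def shiftedPoint (δ X s : ℝ) : ℂ :=
  (1 - Complex.exp (Complex.I * (δ * s : ℝ))) / δ + X * Complex.exp (Complex.I * (δ * s : ℝ))

theorem norm_shiftedPoint_le {δ : ℝ} (hδ : 0 < δ) (X s : ℝ) :
    ‖shiftedPoint δ X s‖ ≤ |X| + |s| := by
  refine (norm_add_le _ _).trans ?_
  have h1 : ‖1 - Complex.exp (Complex.I * (δ * s : ℝ))‖ ≤ δ * |s| := by
    rw [norm_sub_rev]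
    refine Real.norm_exp_I_mul_ofReal_sub_one_le.trans ?_
    rw [Real.norm_eq_abs, abs_mul, abs_of_pos hδ]
  have h2 : ‖Complex.exp (Complex.I * (δ * s : ℝ))‖ = 1 := by
    rw [mul_comm]; exact Complex.norm_exp_ofReal_mul_I _
  rw [norm_div, norm_mul, h2, mul_one, Complex.norm_real, Complex.norm_real, Real.norm_eq_abs,
    Real.norm_eq_abs, abs_of_pos hδ, add_comm]
  gcongr
  rw [div_le_iff₀ hδ]
  linarith

/-- The quotient (e^{iδs} - 1)/δ is a difference quotient at 0 of t ↦ e^{its}, with derivative is.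
-/
theorem IsSaddle.tendsto_shiftedPoint (h : IsSaddle k x δ) (X s : ℝ) :
    Tendsto (fun n => shiftedPoint (δ n) X s) atTop (𝓝 ((X : ℂ) - Complex.I * s)) := by
  have hd : HasDerivAt (fun t : ℝ => Complex.exp (Complex.I * (t * s : ℝ)))
      (Complex.I * s) 0 := by
    have h1 : HasDerivAt (fun t : ℝ => Complex.I * (t * s : ℝ)) (Complex.I * s) 0 := by
      have := ((hasDerivAt_id (0 : ℝ)).mul_const s).ofReal_comp.const_mul Complex.I
      simpa using this
    simpa using h1.cexp
  have hδ0 : Tendsto δ atTop (𝓝[≠] 0) :=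
    tendsto_nhdsWithin_iff.2 ⟨h.tendsto_δ, h.δ_pos.mono fun n hn => hn.ne'⟩
  have h1 := hd.tendsto_slope_zero.comp hδ0
  have h2 : Tendsto (fun n => Complex.exp (Complex.I * (δ n * s : ℝ))) atTop (𝓝 1) := by
    have := hd.continuousAt.tendsto.comp h.tendsto_δ
    simpa [Function.comp_def] using this
  have h3 := (h2.const_mul (X : ℂ)).sub h1
  rw [mul_one] at h3
  refine h3.congr fun n => ?_
  simp only [Function.comp_apply, zero_add, zero_mul, Complex.ofReal_zero, mul_zero,
    Complex.exp_zero, Complex.real_smul, shiftedPoint]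
  push_cast
  ring

theorem IsSaddle.tendsto_integral (hk : 2 ≤ k) (h : IsSaddle k x δ) (X : ℝ) (d : ℕ) :
    Tendsto (fun n => ∫ s in Set.Ioc (-(Real.pi / δ n)) (Real.pi / δ n),
      weight k n (x n) (δ n) s * shiftedPoint (δ n) X s ^ d) atTop
      (𝓝 (∫ s : ℝ, (Real.exp (-s ^ 2 / 4) : ℂ) * ((X : ℂ) - Complex.I * s) ^ d)) := by
  -- The power d of 1 + s² absorbs (|X| + |s|)^d; one more leaves the integrable 1/(1 + s²).
  obtain ⟨M, hM, hbound⟩ := h.eventually_norm_weight_le hk (d + 1)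
  simp only [← integral_indicator measurableSet_Ioc]
  refine tendsto_integral_filter_of_dominated_convergence
    (fun s => M * (|X| + 1) ^ d * (1 + s ^ 2)⁻¹) ?_ ?_ (integrable_inv_one_add_sq.const_mul _) ?_
  · filter_upwards [h.x_pos] with n hx
    refine AEStronglyMeasurable.indicator ?_ measurableSet_Ioc
    refine Continuous.aestronglyMeasurable ?_
    have hc : Continuous fun s : ℝ => logGen k (x n + (δ n * s : ℝ) * Complex.I) :=
      (continuous_logGen (by omega : k ≠ 0) hx).comp (continuous_const.mul continuous_id)
    unfold weight shiftedPoint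
    fun_prop
  · filter_upwards [hbound, h.δ_pos] with n hn hδ
    refine Eventually.of_forall fun s => ?_
    by_cases hs : s ∈ Set.Ioc (-(Real.pi / δ n)) (Real.pi / δ n)
    · rw [Set.indicator_of_mem hs, norm_mul, norm_pow]
      have hsπ : |δ n * s| ≤ Real.pi := by
        rw [abs_mul, abs_of_pos hδ, mul_comm, ← le_div_iff₀ hδ]
        exact abs_le.2 ⟨hs.1.le, hs.2⟩
      calc _ ≤ M / (1 + s ^ 2) ^ (d + 1) * (|X| + |s|) ^ d := by
            gcongr
            · exact hn s hsπ
            · exact norm_shiftedPoint_le hδ X s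
        _ ≤ M / (1 + s ^ 2) ^ (d + 1) * ((|X| + 1) ^ d * (1 + s ^ 2) ^ d) := by
            gcongr
            exact add_abs_pow_le X s d
        _ = _ := by field_simp; ring
    · rw [Set.indicator_of_notMem hs, norm_zero]
      positivity
  · refine Eventually.of_forall fun s => ?_
    refine ((h.tendsto_weight hk s).mul ((h.tendsto_shiftedPoint X s).pow d)).congr' ?_
    have h1 := (h.tendsto_δ.mul_const s).abs
    rw [zero_mul, abs_zero] at h1
    filter_upwards [h1.eventually_lt_const Real.pi_pos, h.δ_pos] with n hn hδ
    rw [Set.indicator_of_mem]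
    rw [abs_mul, abs_of_pos hδ, mul_comm, ← lt_div_iff₀ hδ, abs_lt] at hn
    exact ⟨hn.1, hn.2.le⟩

end RegularPartition

/-! ### Jensen polynomials as integrals, and the conclusion -/

namespace RegularPartition

open Filter Topology MeasureTheory Polynomial

theorem isSaddle_A_delta {k : ℕ} (hk : 2 ≤ k) (d : ℕ) : IsSaddle k (A k d) (delta k) where
  x_pos := eventually_A_pos hk d
  x_lim := tendsto_A k d
  δ_pos := eventually_delta_pos hk
  ratio := by
    rw [poleCoeff_eq hk]; exact tendsto_delta_sq_div_A_cube hk d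
  stationary := by
    simp only [poleCoeff_eq hk]; exact tendsto_delta_mul_sub hk d

/-- The sum over j collapses to (1 + (δX - 1)e^{iθ})^d under Cauchy's integral, since the factors
e^{±jx} cancel. The substitution θ = δs turns this power into δ^d `shiftedPoint`^d and contributes
one further δ. -/
theorem integral_weight_mul_shiftedPoint_pow {k : ℕ} (hk : k ≠ 0) {x δ : ℝ} (hx : 0 < x)
    (hδ : 0 < δ) (X : ℝ) (d n : ℕ) :
    ((2 * Real.pi : ℝ) : ℂ) * ∑ j ∈ Finset.range (d + 1), (d.choose j : ℂ) *
      regularCount k (n + j) * ((δ * X - 1) * Real.exp (-x) : ℝ) ^ j =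
    (δ : ℂ) ^ (d + 1) * Complex.exp (logGen k x + n * x) *
      ∫ s in Set.Ioc (-(Real.pi / δ)) (Real.pi / δ),
        weight k n x δ s * shiftedPoint δ X s ^ d := by
  have hδ' : (δ : ℂ) ≠ 0 := Complex.ofReal_ne_zero.2 hδ.ne'
  set G : ℝ → ℂ := fun θ => Complex.exp (logGen k (x + θ * Complex.I)) *
    Complex.exp (n * (x + θ * Complex.I)) *
    (1 + ((δ * X - 1 : ℝ) : ℂ) * Complex.exp (Complex.I * θ)) ^ d with hG
  have hcont : Continuous fun θ : ℝ => logGen k (x + θ * Complex.I) := continuous_logGen hk hx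
  have h1 : ((2 * Real.pi : ℝ) : ℂ) * ∑ j ∈ Finset.range (d + 1), (d.choose j : ℂ) *
      regularCount k (n + j) * ((δ * X - 1) * Real.exp (-x) : ℝ) ^ j =
      ∫ θ in (-Real.pi)..Real.pi, G θ := by
    rw [Finset.mul_sum]
    have e : ∀ θ, G θ = ∑ j ∈ Finset.range (d + 1),
        ((d.choose j : ℂ) * ((δ * X - 1) * Real.exp (-x) : ℝ) ^ j) *
        (Complex.exp (logGen k (x + θ * Complex.I)) *
          Complex.exp ((n + j : ℕ) * (x + θ * Complex.I))) := by
      intro θ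
      simp only [hG]
      rw [add_comm 1, add_pow, Finset.mul_sum]
      refine Finset.sum_congr rfl fun j _ => ?_
      have e2 : Complex.exp (((n + j : ℕ) : ℂ) * (x + θ * Complex.I)) =
          Complex.exp (n * (x + θ * Complex.I)) *
            (Complex.exp x * Complex.exp (Complex.I * θ)) ^ j := by
        rw [← Complex.exp_add, ← Complex.exp_nat_mul, ← Complex.exp_add]
        congr 1
        push_cast
        ring
      have e3 : Complex.exp (-(x : ℂ)) * Complex.exp x = 1 := by rw [← Complex.exp_add]; simp
      rw [e2, one_pow, mul_one, mul_pow, mul_pow]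
      push_cast
      rw [mul_pow]
      have e4 : Complex.exp (-(x : ℂ)) ^ j * Complex.exp x ^ j = 1 := by
        rw [← mul_pow, e3, one_pow]
      linear_combination (-(d.choose j : ℂ) * ((δ : ℂ) * X - 1) ^ j *
        Complex.exp (Complex.I * θ) ^ j * Complex.exp (logGen k (x + θ * Complex.I)) *
          Complex.exp (n * (x + θ * Complex.I))) * e4
    simp only [e]
    rw [intervalIntegral.integral_finsetSum]
    · refine Finset.sum_congr rfl fun j _ => ?_
      rw [intervalIntegral.integral_const_mul, integral_exp_logGen hk hx]
      ring
    · intro j _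
      exact Continuous.intervalIntegrable (by fun_prop) _ _
  have h2 : ∀ s : ℝ, G (δ * s) = Complex.exp (logGen k x + n * x) * (δ : ℂ) ^ d *
      (weight k n x δ s * shiftedPoint δ X s ^ d) := by
    intro s
    simp only [hG, weight]
    have e1 : 1 + ((δ * X - 1 : ℝ) : ℂ) * Complex.exp (Complex.I * (δ * s : ℝ)) =
        δ * shiftedPoint δ X s := by
      unfold shiftedPoint
      push_cast
      field_simp
      ring
    rw [e1, mul_pow]
    have e2 : Complex.exp (logGen k (x + (δ * s : ℝ) * Complex.I)) *
        Complex.exp (n * (x + (δ * s : ℝ) * Complex.I)) = Complex.exp (logGen k x + n * x) *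
        Complex.exp (logGen k (x + (δ * s : ℝ) * Complex.I) - logGen k x +
          n * (δ * s : ℝ) * Complex.I) := by
      rw [← Complex.exp_add, ← Complex.exp_add]
      congr 1
      ring
    rw [e2]
    ring
  rw [h1]
  have h3 := intervalIntegral.smul_integral_comp_mul_left (a := -(Real.pi / δ)) (b := Real.pi / δ) G δ
  rw [show δ * -(Real.pi / δ) = -Real.pi by field_simp,
    show δ * (Real.pi / δ) = Real.pi by field_simp] at h3
  rw [← h3]
  simp only [h2]
  rw [intervalIntegral.integral_const_mul, intervalIntegral.integral_of_le (by
    have := div_pos Real.pi_pos hδ; linarith), Complex.real_smul]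
  ring

theorem eval_jensen (α : ℕ → ℝ) (d n : ℕ) (y : ℝ) :
    (jensen α d n).eval y = ∑ j ∈ Finset.range (d + 1), (d.choose j : ℝ) * α (n + j) * y ^ j := by
  simp [jensen, eval_finsetSum]

theorem eval_renormalizedJensen (α A δ : ℕ → ℝ) (d n : ℕ) (X : ℝ) :
    (renormalizedJensen α A δ d n).eval X = (δ n)⁻¹ ^ d / α n *
      ∑ j ∈ Finset.range (d + 1), (d.choose j : ℝ) * α (n + j) *
        ((δ n * X - 1) * Real.exp (-A n)) ^ j := by
  rw [renormalizedJensen, eval_mul, eval_C, eval_comp, eval_jensen]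
  simp only [eval_mul, eval_C, eval_sub, eval_X, eval_one, Real.exp_neg, mul_comm (Real.exp _)⁻¹]

theorem eval_renormalizedJensenRegular {k : ℕ} (hk : k ≠ 0) (d n : ℕ) (X : ℝ)
    (hx : 0 < A k d n) (hδ : 0 < delta k n) :
    (((renormalizedJensenRegular k d n).eval X : ℝ) : ℂ) =
      (∫ s in Set.Ioc (-(Real.pi / delta k n)) (Real.pi / delta k n),
        weight k n (A k d n) (delta k n) s * shiftedPoint (delta k n) X s ^ d) /
      ∫ s in Set.Ioc (-(Real.pi / delta k n)) (Real.pi / delta k n),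
        weight k n (A k d n) (delta k n) s * shiftedPoint (delta k n) X s ^ 0 := by
  have h1 := integral_weight_mul_shiftedPoint_pow hk hx hδ X d n
  have h0 := integral_weight_mul_shiftedPoint_pow hk hx hδ X 0 n
  rw [renormalizedJensenRegular, eval_renormalizedJensen]
  simp only [zero_add, Finset.range_one, Finset.sum_singleton, Nat.choose_self, Nat.cast_one,
    one_mul, add_zero, pow_zero, mul_one, pow_one] at h0 ⊢
  have hE := Complex.exp_ne_zero (logGen k (A k d n) + n * A k d n)
  have hδ' : (delta k n : ℂ) ≠ 0 := Complex.ofReal_ne_zero.2 hδ.ne'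
  have hpi : ((2 * Real.pi : ℝ) : ℂ) ≠ 0 := by
    rw [Complex.ofReal_ne_zero]; positivity
  set E := Complex.exp (logGen k (A k d n) + n * A k d n)
  set I1 := ∫ s in Set.Ioc (-(Real.pi / delta k n)) (Real.pi / delta k n),
    weight k n (A k d n) (delta k n) s * shiftedPoint (delta k n) X s ^ d
  set I0 := ∫ s in Set.Ioc (-(Real.pi / delta k n)) (Real.pi / delta k n),
    weight k n (A k d n) (delta k n) s
  have h1' := (eq_div_iff hpi).2 ((mul_comm _ _).trans h1)
  have h0' := (eq_div_iff hpi).2 ((mul_comm _ _).trans h0)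
  push_cast at h1' h0' ⊢
  rw [h1', h0']
  -- If the denominator vanishes then so does p_k(n), and both sides are 0 by the convention for
  -- division by 0.
  by_cases hI : I0 = 0
  · simp [hI]
  · push_cast at hpi
    rw [inv_pow]
    field_simp
    ring

theorem tendsto_eval_renormalizedJensenRegular {k : ℕ} (hk : 2 ≤ k) (d : ℕ) (X : ℝ) :
    Tendsto (fun n => (renormalizedJensenRegular k d n).eval X) atTop
      (𝓝 ((hermiteH d).eval X)) := by
  have hS := isSaddle_A_delta hk d
  have h0 := hS.tendsto_integral hk X 0
  have h1 := hS.tendsto_integral hk X d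
  rw [integral_gaussian_mul_pow] at h0 h1
  have hG := integral_exp_neg_sq_div_four_ne_zero
  have h2 := h1.div h0 (by simpa [hermiteH_zero] using hG)
  rw [hermiteH_zero, eval_one, Complex.ofReal_one, one_mul, mul_div_assoc, div_self hG,
    mul_one] at h2
  have h3 := (Complex.continuous_re.tendsto _).comp h2
  rw [Complex.ofReal_re] at h3
  refine h3.congr' ?_
  filter_upwards [hS.x_pos, hS.δ_pos] with n hx hδ
  rw [Function.comp_apply, Pi.div_apply, ← eval_renormalizedJensenRegular (by omega) d n X hx hδ,
    Complex.ofReal_re]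

theorem natDegree_jensen_le (α : ℕ → ℝ) (d n : ℕ) : (jensen α d n).natDegree ≤ d := by
  refine natDegree_sum_le_of_forall_le _ _ fun j hj => ?_
  exact (natDegree_C_mul_X_pow_le _ _).trans (Nat.lt_succ_iff.1 (Finset.mem_range.1 hj))

theorem natDegree_renormalizedJensen_le (α A δ : ℕ → ℝ) (d n : ℕ) :
    (renormalizedJensen α A δ d n).natDegree ≤ d := by
  refine (natDegree_C_mul_le _ _).trans (natDegree_comp_le.trans ?_)
  have h1 : (C (Real.exp (A n))⁻¹ * (C (δ n) * X - 1)).natDegree ≤ 1 := by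
    refine (natDegree_C_mul_le _ _).trans ?_
    rw [← C_1]
    exact (natDegree_sub_C (a := (1 : ℝ))).trans_le ((natDegree_C_mul_le _ _).trans natDegree_X_le)
  calc _ ≤ d * 1 := Nat.mul_le_mul (natDegree_jensen_le α d n) h1
    _ = d := mul_one d

/-- Pointwise convergence of polynomials of bounded degree is uniform on compact sets. -/
theorem tendstoUniformlyOn_of_tendsto_eval {P : ℕ → ℝ[X]} {Q : ℝ[X]} {d : ℕ}
    (hP : ∀ n, (P n).natDegree ≤ d) (hQ : Q.natDegree ≤ d)
    (h : ∀ x, Tendsto (fun n => (P n).eval x) atTop (𝓝 (Q.eval x))) {K : Set ℝ}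
    (hK : IsCompact K) :
    TendstoUniformlyOn (fun n x => (P n).eval x) (fun x => Q.eval x) atTop K := by
  -- Lagrange interpolation at 0, ..., d makes the value at x jointly continuous in x and the nodal
  -- values. Currying turns convergence of the nodal values into convergence in the compact-open
  -- topology.
  have hinterp : ∀ R : ℝ[X], R.natDegree ≤ d → ∀ x, R.eval x =
      ∑ i ∈ Finset.range (d + 1), R.eval (i : ℝ) *
        (Lagrange.basis (Finset.range (d + 1)) (fun i : ℕ => (i : ℝ)) i).eval x := by
    intro R hR x
    have h1 := Lagrange.eq_interpolate (s := Finset.range (d + 1)) (v := fun i : ℕ => (i : ℝ))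
      (f := R) (Nat.cast_injective.injOn) (by
        rw [Finset.card_range]
        exact (degree_le_natDegree).trans_lt (by exact_mod_cast Nat.lt_succ_of_le hR))
    conv_lhs => rw [h1, Lagrange.interpolate_apply]
    simp [eval_finsetSum]
  let F : C((ℕ → ℝ) × ℝ, ℝ) := ⟨fun p => ∑ i ∈ Finset.range (d + 1), p.1 i *
    (Lagrange.basis (Finset.range (d + 1)) (fun i : ℕ => (i : ℝ)) i).eval p.2, by fun_prop⟩
  have hlim : Tendsto (fun n => fun i : ℕ => (P n).eval (i : ℝ)) atTop
      (𝓝 fun i : ℕ => Q.eval (i : ℝ)) := tendsto_pi_nhds.2 fun i => h i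
  have h2 := (F.curry.continuous.tendsto _).comp hlim
  have h3 := ContinuousMap.tendsto_iff_forall_isCompact_tendstoUniformlyOn.1 h2 K hK
  have e1 : (fun n x => (P n).eval x) = fun n x => F (fun i : ℕ => (P n).eval (i : ℝ), x) :=
    funext fun n => funext fun x => hinterp _ (hP n) x
  have e2 : (fun x => Q.eval x) = fun x => F (fun i : ℕ => Q.eval (i : ℝ), x) :=
    funext fun x => hinterp _ hQ x
  rw [e1, e2]
  exact h3

/-- A root z of the Jensen polynomial yields the root (z e^A + 1)/δ of the renormalized one, and
this affine map has real coefficients and nonzero slope. -/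
theorem IsHyperbolic.of_renormalizedJensen {α A δ : ℕ → ℝ} {d n : ℕ} (hδ : δ n ≠ 0)
    (h : IsHyperbolic (renormalizedJensen α A δ d n)) : IsHyperbolic (jensen α d n) := by
  intro z hz
  have hE : (Real.exp (A n) : ℂ) ≠ 0 := Complex.ofReal_ne_zero.2 (Real.exp_pos _).ne'
  have hδ' : (δ n : ℂ) ≠ 0 := Complex.ofReal_ne_zero.2 hδ
  have h1 := h ((z * Real.exp (A n) + 1) / δ n) ?_
  · have e : (z * Real.exp (A n) + 1) / δ n =
        ((Real.exp (A n) / δ n : ℝ) : ℂ) * z + ((1 / δ n : ℝ) : ℂ) := by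
      push_cast; field_simp
    rw [e, Complex.add_im, Complex.im_ofReal_mul, Complex.ofReal_im, add_zero] at h1
    exact (mul_eq_zero.1 h1).resolve_left (div_ne_zero (Real.exp_pos _).ne' hδ)
  · rw [renormalizedJensen, map_mul, aeval_comp]
    have e : aeval ((z * Real.exp (A n) + 1) / δ n)
        (C (Real.exp (A n))⁻¹ * (C (δ n) * X - 1)) = z := by
      simp only [map_mul, map_sub, aeval_C, aeval_X, map_one, Complex.coe_algebraMap]
      rw [mul_div_cancel₀ _ hδ', Complex.ofReal_inv]
      field_simp
      ring
    rw [e, hz, mul_zero]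

theorem exists_forall_isHyperbolic_jensen {k : ℕ} (hk : 2 ≤ k) {d : ℕ} (hd : 1 ≤ d) :
    ∃ N : ℕ, ∀ n : ℕ, N ≤ n → IsHyperbolic (jensen (fun i => (regularCount k i : ℝ)) d n) := by
  obtain ⟨y, hy, halt⟩ := exists_alternating_hermiteH d hd
  have hev : ∀ᶠ n in atTop, ∀ i ∈ Finset.range d,
      (renormalizedJensenRegular k d n).eval (y i) *
        (renormalizedJensenRegular k d n).eval (y (i + 1)) < 0 := by
    rw [Finset.eventually_all]
    intro i hi
    exact ((tendsto_eval_renormalizedJensenRegular hk d (y i)).mul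
      (tendsto_eval_renormalizedJensenRegular hk d (y (i + 1)))).eventually_lt_const
        (halt i (Finset.mem_range.1 hi))
  obtain ⟨N, hN⟩ := eventually_atTop.1 (hev.and (eventually_delta_pos hk))
  refine ⟨N, fun n hn => ?_⟩
  obtain ⟨h1, h2⟩ := hN n hn
  exact IsHyperbolic.of_renormalizedJensen h2.ne' (isHyperbolic_of_alternating hd
    (natDegree_renormalizedJensen_le _ _ _ d n) hy fun i hi => h1 i (Finset.mem_range.2 hi))

end RegularPartition

theorem theoremC7 (k : ℕ) (hk : 2 ≤ k) (d : ℕ) (hd : 1 ≤ d) :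
    (∀ K : Set ℝ, IsCompact K →
      TendstoUniformlyOn
        (fun (n : ℕ) (x : ℝ) => (RegularPartition.renormalizedJensenRegular k d n).eval x)
        (fun x : ℝ => (RegularPartition.hermiteH d).eval x) Filter.atTop K) ∧
    (∃ N : ℕ, ∀ n : ℕ, N ≤ n →
      RegularPartition.IsHyperbolic
        (RegularPartition.jensen (fun i => (RegularPartition.regularCount k i : ℝ)) d n)) :=
  ⟨fun _ hK => RegularPartition.tendstoUniformlyOn_of_tendsto_eval
    (fun n => RegularPartition.natDegree_renormalizedJensen_le _ _ _ d n)
    (RegularPartition.natDegree_hermiteH_le d)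
    (RegularPartition.tendsto_eval_renormalizedJensenRegular hk d) hK,
    RegularPartition.exists_forall_isHyperbolic_jensen hk hd⟩
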